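/- Notation. For $g\in L^2(\mathbb R)$ put $\langle x\rangle=(1+|x|^2)^{1/2}$, $\|g\|_{H^{1,0}}=\|\langle\nabla\rangle g\|_{L^2}$, $\|g\|_{H^{0,1}}=\|\langle x\rangle g\|_{L^2}$, $\|g\|_{\dot H^{1,0}}=\|\,|\nabla| g\|_{L^2}$, $\|g\|_{\dot H^{0,1}}=\|\,|x|g\|_{L^2}$, where $\langle\nabla\rangle$, $|\nabla|$ and $e^{it\partial_{xx}/2}$ are the Fourier multipliers with symbols $\langle\xi\rangle$, $|\xi|$ and $e^{-it\xi^2/2}$. For $T>1$ and $u_\ast\in H^{1,0}\cap H^{0,1}$, a solution on $[1,T]$ of the one-dimensional cubic NLS $$ i\partial_t u+\tfrac12\partial_{xx}u=|u|^2u,\qquad u|_{t=1}=e^{i\partial_{xx}/2}u_\ast, $$ is a function $u\in C([1,T];H^{1,0}(\mathbb R)\cap H^{0,1}(\mathbb R))$ with $$u(t)=e^{it\partial_{xx}/2}u_\ast-i\int_1^te^{i(t-s)\partial_{xx}/2}|u(s)|^2u(s)\,ds\qquad(1\le t\le T).$$ Its profile is $f(t)=e^{-it\partial_{xx}/2}u(t)$.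 For $\alpha>0$ put, with $L^\infty_T:=L^\infty_t([1,T])$, $$\|u\|_{X_T}=\|t^{1/2}u\|_{L^\infty_TL^\infty_x}+\|t^{-\alpha}u\|_{L^\infty_T\dot H^{1,0}_x}+\|t^{-\alpha}f\|_{L^\infty_T\dot H^{0,1}_x}+\|u\|_{L^\infty_TL^2_x}.$$ Proposition 1.3. There are an absolute constant $C_0\ge 0$ and an $\alpha_0>0$ such that for every $0<\alpha<\alpha_0$ there is a constant $C\ge 0$, depending only on $\alpha$, with the following property. For all $\varepsilon\ge0$, all $T>1$, all $u_\ast$ with $\|u_\ast\|_{H^{1,0}}+\|u_\ast\|_{H^{0,1}}\le\varepsilon$ and every solution $u$ on $[1,T]$ as above, one has $\|u\|_{X_T}<\infty$ and $$\|u\|_{X_T}\le C_0\,\varepsilon+C\,\|u\|_{X_T}^3 .$$ In particular $C_0$ and $C$ are independent of $T$, $\varepsilon$, $u_\ast$ and $u$. -/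

import Mathlib

open MeasureTheory Set Filter Topology
open scoped ENNReal NNReal FourierTransform

noncomputable section

namespace NLS

/-- Complex-valued square integrable functions on the real line. -/
abbrev L2 : Type := Lp ℂ 2 (volume : Measure ℝ)

/-- The symbol of the free Schroedinger group `exp (i t ∂ₓₓ / 2)`, as a function of the variable `k`
of Mathlib's Fourier transform `∫ exp (-2πi x k) g x dx`: the frequency is `ξ = 2πk` and the symbol
is `exp (-i t ξ² / 2)`. -/
def schrodingerSymbol (t k : ℝ) : ℂ :=
  Complex.exp (-Complex.I * ((t * (2 * Real.pi * k) ^ 2 / 2 : ℝ) : ℂ))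

theorem norm_schrodingerSymbol (t k : ℝ) : ‖schrodingerSymbol t k‖ = 1 := by
  rw [schrodingerSymbol, Complex.norm_exp]
  simp [-Complex.ofReal_div, -Complex.ofReal_mul, -Complex.ofReal_pow]

theorem continuous_schrodingerSymbol (t : ℝ) : Continuous (schrodingerSymbol t) := by
  unfold schrodingerSymbol
  fun_prop

theorem memLp_schrodingerSymbol_mul (t : ℝ) (g : L2) :
    MemLp (fun k => schrodingerSymbol t k * g k) 2 volume := by
  refine (Lp.memLp g).congr_norm ?_ (Eventually.of_forall fun k => ?_)
  · exact (continuous_schrodingerSymbol t).aestronglyMeasurable.mul (Lp.aestronglyMeasurable g)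
  · simp [norm_schrodingerSymbol]

/-- The free Schroedinger group `exp (i t ∂ₓₓ / 2)` on `L²(ℝ)`, as a Fourier multiplier. -/
def freeGroup (t : ℝ) (g : L2) : L2 :=
  𝓕⁻ ((memLp_schrodingerSymbol_mul t (𝓕 g)).toLp _)

/-- The norm `‖⟨∇⟩ g‖_{L²}` of `H^{1,0}`. -/
def normH10 (g : L2) : ℝ≥0∞ :=
  eLpNorm (fun k : ℝ => Real.sqrt (1 + (2 * Real.pi * k) ^ 2) • (𝓕 g : L2) k) 2 volume

/-- The norm `‖⟨x⟩ g‖_{L²}` of `H^{0,1}`. -/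
def normH01 (g : L2) : ℝ≥0∞ :=
  eLpNorm (fun x : ℝ => Real.sqrt (1 + x ^ 2) • g x) 2 volume

/-- The homogeneous norm `‖|∇| g‖_{L²}`. -/
def normHdot10 (g : L2) : ℝ≥0∞ :=
  eLpNorm (fun k : ℝ => |2 * Real.pi * k| • (𝓕 g : L2) k) 2 volume

/-- The homogeneous norm `‖|x| g‖_{L²}`. -/
def normHdot01 (g : L2) : ℝ≥0∞ :=
  eLpNorm (fun x : ℝ => |x| • g x) 2 volume

open Classical in
/-- The cubic nonlinearity `|v|² v` as an element of `L²(ℝ)`. It is used for `v` in `H¹(ℝ)`,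
which is contained in `L²(ℝ) ∩ L^∞(ℝ)`, so that `|v|² v` does lie in `L²(ℝ)`. -/
def cubic (v : L2) : L2 :=
  if h : MemLp (fun x => ‖v x‖ ^ 2 • v x) 2 volume then h.toLp _ else 0

/-- `u ∈ C([1, T]; H^{1,0} ∩ H^{0,1})`. -/
def ContinuousIntoH (T : ℝ) (u : ℝ → L2) : Prop :=
  (∀ t ∈ Icc 1 T, normH10 (u t) < ∞ ∧ normH01 (u t) < ∞) ∧
  ∀ t₀ ∈ Icc 1 T,
    Tendsto (fun t => normH10 (u t - u t₀) + normH01 (u t - u t₀)) (𝓝[Icc 1 T] t₀) (𝓝 0)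

/-- `u ∈ C([1, T]; H^{1,0} ∩ H^{0,1})` solves `i ∂ₜ u + ½ ∂ₓₓ u = |u|² u` on `[1, T]` with
`u(1) = exp (i ∂ₓₓ / 2) u⋆`, in the sense of the integral (Duhamel) equation
`u(t) = exp (i t ∂ₓₓ / 2) u⋆ - i ∫₁ᵗ exp (i (t - s) ∂ₓₓ / 2) (|u(s)|² u(s)) ds` in `L²(ℝ)`. -/
structure IsSolution (T : ℝ) (uStar : L2) (u : ℝ → L2) : Prop where
  continuous : ContinuousIntoH T u
  duhamel : ∀ t ∈ Icc 1 T,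
    u t = freeGroup t uStar
      - Complex.I • ∫ s in (1 : ℝ)..t, freeGroup (t - s) (cubic (u s))

/-- The profile `f(t) = exp (-i t ∂ₓₓ / 2) u(t)`. -/
def profile (u : ℝ → L2) (t : ℝ) : L2 := freeGroup (-t) (u t)

/-- The `L^∞` norm in time over `[1, T]`. -/
def supTime (T : ℝ) (φ : ℝ → ℝ≥0∞) : ℝ≥0∞ :=
  essSup φ (volume.restrict (Icc 1 T))

/-- The norm of `X_T`. -/
def normX (α T : ℝ) (u : ℝ → L2) : ℝ≥0∞ :=
  supTime T (fun t => ENNReal.ofReal (t ^ (1 / 2 : ℝ)) * eLpNorm (u t) ∞ volume)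
  + supTime T (fun t => ENNReal.ofReal (t ^ (-α)) * normHdot10 (u t))
  + supTime T (fun t => ENNReal.ofReal (t ^ (-α)) * normHdot01 (profile u t))
  + supTime T (fun t => eLpNorm (u t) 2 volume)

end NLS

end

/-! Write `x` for the `X_T` norm of `u` and `f` for its profile. The energy and weighted norms grow
slowly by Duhamel and Grönwall-free integration, the mass is conserved, and the sup norm is
controlled by an approximate ODE for the Fourier transform of `f`.

The central tool is the factorisation `freeGroup_ae_eq` of the free group into chirp, dilation,
Fourier transform, chirp. It turns the weighted norm of `f(s)` into `s` times the derivative norm of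
the chirped solution (`normHdot01_freeGroup`), which is the role usually played by the operator `x +
is∂ₓ`. The chirp has modulus one and so commutes with `|v|²v`. The chain rule `dotH1_cubic_le`
therefore bounds both derivative and weighted norms of the pulled-back nonlinearity by `3‖u‖_∞²`
times the same norm of the solution. With `‖u(s)‖_∞ ≤ x s^{-1/2}` the integrand is at most `3x³
s^{α-1}`, whose integral is at most `3x³ t^α / α` (`growth_bounds`).

For the sup norm, let `w` be the Fourier transform of `chirp s · f`. The same transform of the
pulled-back nonlinearity is exactly `|w|²w / (2πs)` (`chirpFourier_freeGroup_neg_cubic`). Dropping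
the chirp costs `O(s^{-1/4})` times the weighted norm, so at each frequency `i∂ₛf̂ = r f̂ + O(x³
s^{α-5/4})` with `r` real. A real `r` only rotates the phase and the error is integrable, so `|f̂|`
stays bounded by its initial value plus a multiple of `x³` (`norm_le_of_rotation`,
`norm_fourier_profile_le`). The factorisation converts this into `t^{-1/2}` decay of `u`
(`decay_bound`).

Evaluation of `f̂` at one frequency is not continuous on `L²`, so it cannot be moved through the
Duhamel integral. It is replaced by `cutoffFourier`, which is continuous, and the cutoff radius is
sent to infinity at the end. -/

noncomputable section

namespace NLS

/-! ### The Fourier integral and the Fourier transform of `L²`. -/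

/-- A square integrable function is determined by its pairings with Schwartz functions. -/
theorem ae_eq_of_schwartz_pairing_eq {f g : ℝ → ℂ} (hf : LocallyIntegrable f)
    (hg : LocallyIntegrable g)
    (h : ∀ φ : SchwartzMap ℝ ℂ, ∫ x, φ x • f x = ∫ x, φ x • g x) : f =ᵐ[volume] g := by
  refine ae_eq_of_integral_contDiff_smul_eq hf hg fun φ hφ hc => ?_
  have hc' : HasCompactSupport (fun x => (φ x : ℂ)) := hc.comp_left (g := fun r : ℝ => (r : ℂ)) rfl
  have hφ' : ContDiff ℝ (⊤ : ℕ∞) (fun x => (φ x : ℂ)) :=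
    Complex.ofRealCLM.contDiff.comp hφ
  simpa using h (hc'.toSchwartzMap hφ')

theorem locallyIntegrable_coeFn (f : L2) : LocallyIntegrable f :=
  (Lp.memLp f).locallyIntegrable (by norm_num)

theorem continuous_fourier {f : ℝ → ℂ} (hf : Integrable f) : Continuous (𝓕 f) :=
  VectorFourier.fourierIntegral_continuous Real.continuous_fourierChar
    (by exact continuous_inner) hf

theorem integral_fourier_mul {f g : ℝ → ℂ} (hf : Integrable f) (hg : Integrable g) :
    ∫ k, 𝓕 f k * g k = ∫ x, f x * 𝓕 g x := by
  have := VectorFourier.integral_fourierIntegral_smul_eq_flip (μ := volume) (ν := volume)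
    (L := innerₗ ℝ) Real.continuous_fourierChar continuous_inner hf hg
  simp only [flip_innerₗ] at this
  exact this

/-- On `L¹ ∩ L²` the Fourier transform of `L²` is given by the Fourier integral. -/
theorem fourier_ae_eq (f : L2) (hf : Integrable f) :
    (𝓕 f : L2) =ᵐ[volume] 𝓕 (f : ℝ → ℂ) := by
  refine ae_eq_of_schwartz_pairing_eq (locallyIntegrable_coeFn _)
    (continuous_fourier hf).locallyIntegrable fun φ => ?_
  have h := congrArg (fun D : TemperedDistribution ℝ ℂ => D φ)
    (Lp.fourier_toTemperedDistribution_eq f)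
  simp only [TemperedDistribution.fourier_apply, Lp.toTemperedDistribution_apply] at h
  rw [← h]
  simp only [smul_eq_mul, SchwartzMap.fourier_coe]
  rw [← integral_fourier_mul φ.integrable hf]

theorem fourier_toLp_ae_eq {f : ℝ → ℂ} (hf : Integrable f) (hf2 : MemLp f 2 volume) :
    (𝓕 (hf2.toLp f) : L2) =ᵐ[volume] 𝓕 f := by
  have h := fourier_ae_eq (hf2.toLp f) ((integrable_congr hf2.coeFn_toLp).2 hf)
  refine h.trans (Eventually.of_forall fun k => ?_)
  exact Real.fourier_congr_ae hf2.coeFn_toLp k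

theorem memLp_fourier {f : ℝ → ℂ} (hf : Integrable f) (hf2 : MemLp f 2 volume) :
    MemLp (𝓕 f) 2 volume :=
  (memLp_congr_ae (fourier_toLp_ae_eq hf hf2)).1 (Lp.memLp _)

theorem eLpNorm_coeFn (f : L2) : eLpNorm f 2 volume = ‖f‖ₑ := (Lp.enorm_def f).symm

/-- Plancherel's theorem for the Fourier integral on `L¹ ∩ L²`. -/
theorem eLpNorm_fourier {f : ℝ → ℂ} (hf : Integrable f) (hf2 : MemLp f 2 volume) :
    eLpNorm (𝓕 f) 2 volume = eLpNorm f 2 volume := by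
  rw [← eLpNorm_congr_ae (fourier_toLp_ae_eq hf hf2), eLpNorm_coeFn,
    ← eLpNorm_congr_ae hf2.coeFn_toLp, eLpNorm_coeFn, ← ofReal_norm, ← ofReal_norm,
    Lp.norm_fourier_eq]

theorem measurePreserving_neg : MeasurePreserving (fun x : ℝ => -x) volume volume :=
  Measure.measurePreserving_neg volume

theorem fourierInv_eq_comp_neg (f : ℝ → ℂ) : 𝓕⁻ f = fun x => 𝓕 f (-x) := by
  ext x; exact Real.fourierInv_eq_fourier_neg f x

theorem continuous_fourierInv {f : ℝ → ℂ} (hf : Integrable f) : Continuous (𝓕⁻ f) := by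
  rw [fourierInv_eq_comp_neg]
  exact (continuous_fourier hf).comp continuous_neg

/-- On `L¹ ∩ L²` the inverse Fourier transform of `L²` is given by the Fourier integral. -/
theorem fourierInv_ae_eq (f : L2) (hf : Integrable f) :
    (𝓕⁻ f : L2) =ᵐ[volume] 𝓕⁻ (f : ℝ → ℂ) := by
  refine ae_eq_of_schwartz_pairing_eq (locallyIntegrable_coeFn _)
    (continuous_fourierInv hf).locallyIntegrable fun φ => ?_
  have h := congrArg (fun D : TemperedDistribution ℝ ℂ => D φ)
    (Lp.fourierInv_toTemperedDistribution_eq f)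
  simp only [TemperedDistribution.fourierInv_apply, Lp.toTemperedDistribution_apply] at h
  rw [← h]
  simp only [smul_eq_mul, SchwartzMap.fourierInv_coe, fourierInv_eq_comp_neg]
  have e1 := integral_fourier_mul φ.integrable (f := φ)
    (hf.comp_neg (f := fun x => (f : ℝ → ℂ) x))
  -- Reflecting the variable reduces the inverse transform to the forward one.
  have e2 : ∀ k, 𝓕 (fun x => (f : ℝ → ℂ) (-x)) k = 𝓕 (f : ℝ → ℂ) (-k) := by
    intro k
    rw [Real.fourier_eq', Real.fourier_eq', ← integral_neg_eq_self]
    simp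
  simp only [e2] at e1
  rw [← e1, ← integral_neg_eq_self]
  simp

theorem fourierInv_toLp_ae_eq {f : ℝ → ℂ} (hf : Integrable f) (hf2 : MemLp f 2 volume) :
    (𝓕⁻ (hf2.toLp f) : L2) =ᵐ[volume] 𝓕⁻ f := by
  have h := fourierInv_ae_eq (hf2.toLp f) ((integrable_congr hf2.coeFn_toLp).2 hf)
  refine h.trans (Eventually.of_forall fun k => ?_)
  exact Real.fourierInv_congr_ae hf2.coeFn_toLp k

theorem eLpNorm_two_eq {E : Type*} [NormedAddCommGroup E] (f : ℝ → E) :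
    eLpNorm f 2 volume = (∫⁻ x, ‖f x‖ₑ ^ 2) ^ (1 / 2 : ℝ) := by
  rw [eLpNorm_eq_lintegral_rpow_enorm_toReal (by norm_num) (by norm_num)]
  simp

/-- Dominated convergence in `L²` for bounded multipliers. -/
theorem tendsto_eLpNorm_mul_sub {ι : Type*} {l : Filter ι} [l.IsCountablyGenerated]
    {m : ι → ℝ → ℂ} {m₀ g : ℝ → ℂ} (hg : MemLp g 2 volume)
    (hm : ∀ i, AEStronglyMeasurable (m i) volume) (hm₀ : AEStronglyMeasurable m₀ volume)
    (hb : ∀ i x, ‖m i x‖ ≤ 1) (hb₀ : ∀ x, ‖m₀ x‖ ≤ 1)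
    (hlim : ∀ x, Tendsto (fun i => m i x) l (𝓝 (m₀ x))) :
    Tendsto (fun i => eLpNorm (fun x => m i x * g x - m₀ x * g x) 2 volume) l (𝓝 0) := by
  simp only [eLpNorm_two_eq]
  have h0 : Tendsto (fun i => ∫⁻ x, ‖m i x * g x - m₀ x * g x‖ₑ ^ 2) l (𝓝 (∫⁻ _ : ℝ, 0)) := by
    refine tendsto_lintegral_filter_of_dominated_convergence' (fun x => (2 * ‖g x‖ₑ) ^ 2)
      (Eventually.of_forall fun i => ?_)
      (Eventually.of_forall fun i => Eventually.of_forall fun x => ?_) ?_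
      (Eventually.of_forall fun x => ?_)
    · exact ((((hm i).mul hg.1).sub (hm₀.mul hg.1)).enorm).pow_const 2
    · gcongr
      rw [← sub_mul, enorm_mul]
      gcongr
      rw [← ofReal_norm, show (2 : ℝ≥0∞) = ENNReal.ofReal 2 by simp]
      exact ENNReal.ofReal_le_ofReal ((norm_sub_le _ _).trans (by linarith [hb i x, hb₀ x]))
    · simp_rw [mul_pow]
      rw [lintegral_const_mul' _ _ (by simp)]
      have := hg.2
      rw [eLpNorm_two_eq] at this
      refine ENNReal.mul_ne_top (by simp) ?_
      intro h
      rw [h] at this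
      simp at this
    · have h1 : Tendsto (fun i => ‖m i x * g x - m₀ x * g x‖ₑ) l (𝓝 0) := by
        have h2 : Tendsto (fun i => m i x * g x - m₀ x * g x) l (𝓝 (m₀ x * g x - m₀ x * g x)) :=
          ((hlim x).mul_const _).sub_const _
        simpa using h2.enorm
      simpa using ENNReal.Tendsto.pow (n := 2) h1
  have h3 := h0.ennrpow_const (1 / 2 : ℝ)
  simpa using h3

/-! ### The Schrödinger kernel and the chirp factorisation of the free group. -/

/-- The quadratic phase `exp (i x² / 2t)`. -/
def chirp (t x : ℝ) : ℂ := Complex.exp (Complex.I * ((x ^ 2 / (2 * t) : ℝ) : ℂ))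

theorem norm_chirp (t x : ℝ) : ‖chirp t x‖ = 1 := by
  rw [chirp, mul_comm]; exact Complex.norm_exp_ofReal_mul_I _

theorem continuous_chirp (t : ℝ) : Continuous (chirp t) := by
  unfold chirp; fun_prop

theorem chirp_neg_time_mul (t x : ℝ) : chirp (-t) x * chirp t x = 1 := by
  rw [chirp, chirp, ← Complex.exp_add, Complex.exp_eq_one_iff]
  exact ⟨0, by push_cast; ring⟩

theorem integrable_mul_of_norm_one {m f : ℝ → ℂ} (hm : Continuous m) (h1 : ∀ x, ‖m x‖ = 1)
    (hf : Integrable f) : Integrable (fun x => m x * f x) :=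
  hf.bdd_mul (c := 1) hm.aestronglyMeasurable (Eventually.of_forall fun x => (h1 x).le)

theorem memLp_mul_of_norm_one {m f : ℝ → ℂ} {p : ℝ≥0∞} (hm : Continuous m) (h1 : ∀ x, ‖m x‖ = 1)
    (hf : MemLp f p volume) : MemLp (fun x => m x * f x) p volume :=
  hf.congr_norm (hm.aestronglyMeasurable.mul hf.1) (Eventually.of_forall fun x => by simp [h1])

/-- The constant `(2π i t)^{-1/2}` of the free Schroedinger kernel. -/
def kernelConst (t : ℝ) : ℂ := 1 / (2 * Real.pi * t * Complex.I : ℂ) ^ (1 / 2 : ℂ)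

theorem norm_fourier_le {f : ℝ → ℂ} (k : ℝ) : ‖𝓕 f k‖ ≤ ∫ x, ‖f x‖ :=
  VectorFourier.norm_fourierIntegral_le_integral_norm _ _ _ f k

/-- The exponent on the left is `i(y-x)²/(2t)`; expanding the square gives one chirp in each
variable and a cross term that is the Fourier character at frequency `x/(2πt)`. -/
theorem kernel_eq {t : ℝ} (ht : t ≠ 0) (x y : ℝ) :
    Complex.exp (-Real.pi / (2 * Real.pi * t * Complex.I) * (y - x) ^ 2) =
      chirp t x * (Complex.exp (↑(-2 * Real.pi * y * (x / (2 * Real.pi * t))) * Complex.I)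
        * chirp t y) := by
  have hpi : (Real.pi : ℂ) ≠ 0 := by exact_mod_cast Real.pi_ne_zero
  have ht' : (t : ℂ) ≠ 0 := by exact_mod_cast ht
  rw [chirp, chirp, ← Complex.exp_add, ← Complex.exp_add]
  congr 1
  push_cast
  field_simp
  ring_nf
  simp only [Complex.I_sq]
  ring

/-- The Gaussian regularisation of the Schroedinger group in terms of its kernel. -/
theorem fourierInv_gaussian_mul_fourier {f : ℝ → ℂ} (hf : Integrable f) {b : ℂ} (hb : 0 < b.re)
    (x : ℝ) :
    𝓕⁻ (fun k : ℝ => Complex.exp (-Real.pi * b * k ^ 2) * 𝓕 f k) x =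
      ∫ y, f y * (1 / b ^ (1 / 2 : ℂ) * Complex.exp (-Real.pi / b * (y - x) ^ 2)) := by
  -- The imaginary shift `i x` encodes the character `exp (2πi k x)` of the inverse transform as a
  -- linear term in the Gaussian exponent.
  have hG := fourier_gaussian_pi' hb (Complex.I * x)
  have hint : Integrable fun k : ℝ =>
      Complex.exp (-Real.pi * b * k ^ 2 + 2 * Real.pi * (Complex.I * x) * k) := by
    have := integrable_cexp_quadratic' (b := -Real.pi * b)
      (by simpa using mul_pos Real.pi_pos hb) (2 * Real.pi * (Complex.I * x)) 0
    simpa using this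
  have h := integral_fourier_mul hf hint
  rw [hG] at h
  rw [Real.fourierInv_eq']
  calc _ = ∫ k, 𝓕 f k *
        Complex.exp (-Real.pi * b * k ^ 2 + 2 * Real.pi * (Complex.I * x) * k) := by
        refine integral_congr_ae (Eventually.of_forall fun k => ?_)
        simp only [smul_eq_mul, Complex.exp_add]
        rw [mul_comm (Complex.exp (-Real.pi * b * k ^ 2)) (𝓕 f k), mul_left_comm,
          mul_comm (Complex.exp (-Real.pi * b * k ^ 2))]
        congr 3
        simp [mul_comm, mul_left_comm, mul_assoc]
    _ = _ := by
        rw [h]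
        refine integral_congr_ae (Eventually.of_forall fun y => ?_)
        have : (y : ℂ) + Complex.I * (Complex.I * x) = y - x := by
          rw [← mul_assoc, Complex.I_mul_I]; ring
        simp only [this]

theorem schrodingerSymbol_eq (t k : ℝ) :
    schrodingerSymbol t k =
      Complex.exp (-Real.pi * (2 * Real.pi * t * Complex.I) * k ^ 2) := by
  rw [schrodingerSymbol]; congr 1; push_cast; ring

/-- The factorisation of the free Schroedinger group into chirps, a dilation and a Fourier
transform, on `L¹ ∩ L²`. -/
theorem freeGroup_ae_eq {t : ℝ} (ht : t ≠ 0) (f : L2) (hf : Integrable f) :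
    freeGroup t f =ᵐ[volume] fun x =>
      kernelConst t * chirp t x * 𝓕 (fun y => chirp t y * f y) (x / (2 * Real.pi * t)) := by
  -- The added real part `1/(n+1)` makes the multiplier an integrable Gaussian, for which the kernel
  -- formula holds; the Schrödinger symbol is the limit.
  set b : ℕ → ℂ := fun n => ((1 / ((n : ℝ) + 1) : ℝ) : ℂ) + 2 * Real.pi * t * Complex.I with hbdef
  set b₀ : ℂ := 2 * Real.pi * t * Complex.I with hb₀
  have hb₀ne : b₀ ≠ 0 := by
    simp [hb₀, ht, Real.pi_ne_zero]
  have hbre : ∀ n, (b n).re = 1 / ((n : ℝ) + 1) := by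
    have h0 : b₀.re = 0 := by simp [hb₀]
    intro n
    rw [hbdef]
    simp only [Complex.add_re, Complex.ofReal_re, h0, add_zero]
  have hbpos : ∀ n, 0 < (b n).re := fun n => by rw [hbre]; positivity
  have hblim : Tendsto b atTop (𝓝 b₀) := by
    have h1 : Tendsto (fun n : ℕ => ((1 / ((n : ℝ) + 1) : ℝ) : ℂ)) atTop (𝓝 ((0 : ℝ) : ℂ)) :=
      (Complex.continuous_ofReal.tendsto 0).comp tendsto_one_div_add_atTop_nhds_zero_nat
    have h2 := h1.add_const b₀
    rwa [Complex.ofReal_zero, zero_add] at h2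
  set m : ℕ → ℝ → ℂ := fun n k => Complex.exp (-Real.pi * b n * k ^ 2) with hm
  have hmc : ∀ n, Continuous (m n) := fun n => by simp only [hm]; fun_prop
  have hmb : ∀ n k, ‖m n k‖ ≤ 1 := by
    intro n k
    simp only [hm]
    rw [Complex.norm_exp, Real.exp_le_one_iff]
    have : (-Real.pi * b n * k ^ 2 : ℂ).re = -(Real.pi * (b n).re * k ^ 2) := by
      rw [← Complex.ofReal_pow, Complex.re_mul_ofReal, ← Complex.ofReal_neg,
        Complex.re_ofReal_mul]; ring
    rw [this]
    have := hbpos n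
    have := Real.pi_pos
    rw [neg_nonpos]
    positivity
  have hFmem : MemLp (𝓕 (f : ℝ → ℂ)) 2 volume := memLp_fourier hf (Lp.memLp f)
  have hg2 : ∀ n, MemLp (fun k => m n k * 𝓕 (f : ℝ → ℂ) k) 2 volume := fun n =>
    hFmem.of_le ((hmc n).aestronglyMeasurable.mul hFmem.1) (Eventually.of_forall fun k => by
      rw [norm_mul]; exact mul_le_of_le_one_left (norm_nonneg _) (hmb n k))
  have hg1 : ∀ n, Integrable (fun k => m n k * 𝓕 (f : ℝ → ℂ) k) := by
    intro n
    have hmi : Integrable (m n) := by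
      have := integrable_cexp_quadratic' (b := -Real.pi * b n)
        (by simpa using mul_pos Real.pi_pos (hbpos n)) 0 0
      simpa only [zero_mul, add_zero] using this
    exact hmi.mul_bdd (c := ∫ x, ‖(f : ℝ → ℂ) x‖) (continuous_fourier hf).aestronglyMeasurable
      (Eventually.of_forall fun k => norm_fourier_le k)
  -- convergence in `L²`
  have hL2 : Tendsto (fun n => (𝓕⁻ ((hg2 n).toLp _) : L2)) atTop (𝓝 (freeGroup t f)) := by
    have hcont : Continuous (fun g : L2 => (𝓕⁻ g : L2)) :=
      (Lp.fourierTransformₗᵢ ℝ ℂ).symm.continuous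
    refine (hcont.tendsto _).comp ?_
    rw [Lp.tendsto_Lp_iff_tendsto_eLpNorm']
    have hd := tendsto_eLpNorm_mul_sub (l := atTop) (m := m) (m₀ := schrodingerSymbol t) hFmem
      (fun n => (hmc n).aestronglyMeasurable) (continuous_schrodingerSymbol t).aestronglyMeasurable
      hmb (fun k => (norm_schrodingerSymbol t k).le) (fun k => by
        rw [schrodingerSymbol_eq]
        exact (Complex.continuous_exp.tendsto _).comp
          ((hblim.const_mul _).mul_const _))
    refine hd.congr fun n => eLpNorm_congr_ae ?_
    filter_upwards [(hg2 n).coeFn_toLp, (memLp_schrodingerSymbol_mul t (𝓕 f)).coeFn_toLp,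
      fourier_ae_eq f hf] with k h1 h2 h3
    simp only [Pi.sub_apply]
    rw [h1, h2, h3]
  -- Convergence in `L²` gives convergence almost everywhere along a subsequence, so it suffices to
  -- identify the pointwise limit of the kernel formulas.
  obtain ⟨ns, hns, hae⟩ := (tendstoInMeasure_of_tendsto_Lp hL2).exists_seq_tendsto_ae
  have hall : ∀ᵐ x, ∀ n, (𝓕⁻ ((hg2 n).toLp _) : L2) x
      = 𝓕⁻ (fun k => m n k * 𝓕 (f : ℝ → ℂ) k) x :=
    ae_all_iff.2 fun n => fourierInv_toLp_ae_eq (hg1 n) (hg2 n)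
  filter_upwards [hae, hall] with x hx1 hx2
  simp only [hx2] at hx1
  suffices key : Tendsto (fun n => 𝓕⁻ (fun k => m n k * 𝓕 (f : ℝ → ℂ) k) x) atTop
      (𝓝 (kernelConst t * chirp t x *
        𝓕 (fun y => chirp t y * f y) (x / (2 * Real.pi * t)))) from
    tendsto_nhds_unique hx1 (key.comp hns.tendsto_atTop)
  -- `b₀` is nonzero and purely imaginary, hence off the branch cut, and the square root is
  -- continuous there.
  have hslit : b₀ ∈ Complex.slitPlane := by
    refine Or.inr ?_
    simp [hb₀, ht, Real.pi_ne_zero]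
  have hcpow : Tendsto (fun n => 1 / (b n) ^ (1 / 2 : ℂ)) atTop (𝓝 (1 / b₀ ^ (1 / 2 : ℂ))) := by
    refine Tendsto.div tendsto_const_nhds
      ((continuousAt_cpow_const hslit).tendsto.comp hblim) ?_
    simp [Complex.cpow_eq_zero_iff, hb₀ne]
  have hform : kernelConst t * chirp t x * 𝓕 (fun y => chirp t y * f y) (x / (2 * Real.pi * t))
      = 1 / b₀ ^ (1 / 2 : ℂ) * ∫ y, f y * Complex.exp (-Real.pi / b₀ * (y - x) ^ 2) := by
    rw [kernelConst, mul_assoc, Real.fourier_real_eq_integral_exp_smul, ← integral_const_mul]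
    congr 1
    refine integral_congr_ae (Eventually.of_forall fun y => ?_)
    simp only [smul_eq_mul]
    rw [kernel_eq ht]
    ring
  rw [hform]
  have heq : ∀ n, 𝓕⁻ (fun k => m n k * 𝓕 (f : ℝ → ℂ) k) x =
      1 / (b n) ^ (1 / 2 : ℂ) * ∫ y, f y * Complex.exp (-Real.pi / b n * (y - x) ^ 2) := by
    intro n
    rw [← integral_const_mul]
    refine (fourierInv_gaussian_mul_fourier hf (hbpos n) x).trans
      (integral_congr_ae (Eventually.of_forall fun y => ?_))
    simp only
    ring
  simp only [heq]
  refine hcpow.mul (tendsto_integral_of_dominated_convergence (fun y => ‖f y‖)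
    (fun n => ?_) hf.norm (fun n => Eventually.of_forall fun y => ?_)
    (Eventually.of_forall fun y => ?_))
  · exact hf.1.mul (by fun_prop : Continuous _).aestronglyMeasurable
  · rw [norm_mul]
    refine mul_le_of_le_one_right (norm_nonneg _) ?_
    rw [Complex.norm_exp, Real.exp_le_one_iff]
    have : (-Real.pi / b n * (y - x) ^ 2 : ℂ).re = -(Real.pi * (b n)⁻¹.re * (y - x) ^ 2) := by
      rw [← Complex.ofReal_sub, ← Complex.ofReal_pow, Complex.re_mul_ofReal, ← Complex.ofReal_neg,
        div_eq_mul_inv, Complex.re_ofReal_mul]; ring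
    rw [this, neg_nonpos, Complex.inv_re]
    have h1 := hbpos n
    have h2 := Complex.normSq_nonneg (b n)
    have := Real.pi_pos
    positivity
  · refine Tendsto.const_mul _ ((Complex.continuous_exp.tendsto _).comp
      (Tendsto.mul_const _ (Tendsto.div tendsto_const_nhds hblim hb₀ne)))

theorem norm_kernelConst (t : ℝ) : ‖kernelConst t‖ = 1 / Real.sqrt (2 * Real.pi * |t|) := by
  have h : ((1 / 2 : ℂ)) = ((1 / 2 : ℝ) : ℂ) := by push_cast; ring
  rw [kernelConst, norm_div, h, Complex.norm_cpow_real, ← Real.sqrt_eq_rpow]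
  simp [abs_of_pos Real.pi_pos]

/-- Conjugation commutes with the principal square root away from the negative axis, and `2πit` is
never on it. -/
theorem kernelConst_neg {t : ℝ} (ht : t ≠ 0) :
    kernelConst (-t) = (starRingEnd ℂ) (kernelConst t) := by
  have harg : (2 * Real.pi * t * Complex.I : ℂ).arg ≠ Real.pi := by
    rw [Ne, Complex.arg_eq_pi_iff]
    simp [ht, Real.pi_ne_zero]
  have h := Complex.cpow_conj (2 * Real.pi * t * Complex.I : ℂ) (1 / 2) harg
  simp only [kernelConst, map_div₀, map_one]
  have h2 : (starRingEnd ℂ) (1 / 2 : ℂ) = 1 / 2 := by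
    rw [show (1 / 2 : ℂ) = ((1 / 2 : ℝ) : ℂ) by push_cast; rfl, Complex.conj_ofReal]
  rw [h2] at h
  rw [h, Complex.conj_conj]
  congr 2
  simp only [map_mul, map_ofNat, Complex.conj_ofReal, Complex.conj_I]
  push_cast
  ring

theorem kernelConst_neg_mul {t : ℝ} (ht : 0 < t) :
    kernelConst (-t) * kernelConst t = ((1 / (2 * Real.pi * t) : ℝ) : ℂ) := by
  rw [kernelConst_neg ht.ne', ← Complex.normSq_eq_conj_mul_self, Complex.normSq_eq_norm_sq,
    norm_kernelConst, div_pow, Real.sq_sqrt (by positivity), abs_of_pos ht, one_pow]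

/-! ### Derivative norms through difference quotients. -/

/-- The homogeneous Sobolev norm `‖∂ₓ v‖_{L²}`, for `v ∈ L¹ ∩ L²`, through the Fourier integral. -/
def dotH1 (v : ℝ → ℂ) : ℝ≥0∞ := eLpNorm (fun k : ℝ => |2 * Real.pi * k| • 𝓕 v k) 2 volume

theorem normHdot10_eq_dotH1 (g : L2) (hg : Integrable g) : normHdot10 g = dotH1 g := by
  refine eLpNorm_congr_ae ?_
  filter_upwards [fourier_ae_eq g hg] with k hk
  rw [hk]

theorem dotH1_congr {v w : ℝ → ℂ} (h : v =ᵐ[volume] w) : dotH1 v = dotH1 w := by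
  unfold dotH1
  congr 1
  ext k
  rw [Real.fourier_congr_ae h k]

theorem measurePreserving_add_right' (h : ℝ) :
    MeasurePreserving (fun x : ℝ => x + h) volume volume :=
  measurePreserving_add_right volume h

theorem integrable_translate_sub {v : ℝ → ℂ} (hv : Integrable v) (h : ℝ) :
    Integrable fun x => v (x + h) - v x :=
  (hv.comp_add_right h).sub hv

theorem memLp_translate_sub {v : ℝ → ℂ} {p : ℝ≥0∞} (hv : MemLp v p volume) (h : ℝ) :
    MemLp (fun x => v (x + h) - v x) p volume :=
  (hv.comp_measurePreserving (measurePreserving_add_right' h)).sub hv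

theorem fourier_translate_sub {v : ℝ → ℂ} (hv : Integrable v) (h k : ℝ) :
    𝓕 (fun x => v (x + h) - v x) k =
      (Complex.exp (Complex.I * ((2 * Real.pi * k * h : ℝ) : ℂ)) - 1) * 𝓕 v k := by
  have h1 : 𝓕 (fun x => v (x + h)) k =
      Complex.exp (Complex.I * ((2 * Real.pi * k * h : ℝ) : ℂ)) * 𝓕 v k := by
    have := congrFun (VectorFourier.fourierIntegral_comp_add_right Real.fourierChar volume
      (innerₗ ℝ) v h) k
    refine this.trans ?_
    rw [Circle.smul_def, Real.fourierChar_apply]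
    simp only [innerₗ_apply_apply, smul_eq_mul]
    congr 2
    simp
    ring
  have h2 : 𝓕 (fun x => v (x + h) - v x) k = 𝓕 (fun x => v (x + h)) k - 𝓕 v k := by
    simp only [Real.fourier_real_eq_integral_exp_smul]
    rw [← integral_sub]
    · simp [mul_sub]
    · exact integrable_mul_of_norm_one (by fun_prop)
        (fun x => Complex.norm_exp_ofReal_mul_I _) (hv.comp_add_right h)
    · exact integrable_mul_of_norm_one (by fun_prop)
        (fun x => Complex.norm_exp_ofReal_mul_I _) hv
  rw [h2, h1]; ring

/-- A difference quotient is controlled by the derivative. -/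
theorem eLpNorm_translate_sub_le {v : ℝ → ℂ} (hv : Integrable v) (hv2 : MemLp v 2 volume) (h : ℝ) :
    eLpNorm (fun x => v (x + h) - v x) 2 volume ≤ ENNReal.ofReal |h| * dotH1 v := by
  rw [← eLpNorm_fourier (integrable_translate_sub hv h) (memLp_translate_sub hv2 h)]
  refine eLpNorm_le_mul_eLpNorm_of_ae_le_mul (Eventually.of_forall fun k => ?_) 2
  rw [fourier_translate_sub hv, norm_mul, norm_smul, ← mul_assoc]
  refine mul_le_mul_of_nonneg_right ?_ (norm_nonneg _)
  refine Real.norm_exp_I_mul_ofReal_sub_one_le.trans ?_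
  rw [norm_mul, mul_comm]
  simp

theorem tendsto_difference_quotient (k : ℝ) :
    Tendsto (fun n : ℕ => ((((n : ℝ) + 1) : ℝ) : ℂ) * (Complex.exp (Complex.I *
      ((2 * Real.pi * k * (1 / ((n : ℝ) + 1)) : ℝ) : ℂ)) - 1)) atTop
      (𝓝 (Complex.I * ((2 * Real.pi * k : ℝ) : ℂ))) := by
  have hd : HasDerivAt (fun h : ℝ => Complex.exp (Complex.I * ((2 * Real.pi * k * h : ℝ) : ℂ)))
      (Complex.I * ((2 * Real.pi * k : ℝ) : ℂ)) 0 := by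
    have h1 : HasDerivAt (fun h : ℝ => Complex.I * ((2 * Real.pi * k * h : ℝ) : ℂ))
        (Complex.I * ((2 * Real.pi * k : ℝ) : ℂ)) 0 := by
      have := ((hasDerivAt_id (0 : ℝ)).const_mul (2 * Real.pi * k)).ofReal_comp.const_mul Complex.I
      simpa using this
    have h2 := h1.cexp
    simpa using h2
  have hs := (hasDerivAt_iff_tendsto_slope_zero.1 hd)
  have hn : Tendsto (fun n : ℕ => 1 / ((n : ℝ) + 1)) atTop (𝓝[≠] 0) :=
    tendsto_nhdsWithin_iff.2 ⟨tendsto_one_div_add_atTop_nhds_zero_nat,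
      Eventually.of_forall fun n => by simp; positivity⟩
  refine (hs.comp hn).congr fun n => ?_
  simp

/-- Control of the difference quotients controls the derivative. -/
theorem dotH1_le_of_translate {v : ℝ → ℂ} (hv : Integrable v) (hv2 : MemLp v 2 volume)
    {K K' : ℝ≥0∞} (hK' : K' ≠ ∞)
    (hK : ∀ h : ℝ, 0 < h → eLpNorm (fun x => v (x + h) - v x) 2 volume ≤
      ENNReal.ofReal h * (K + ENNReal.ofReal h * K')) :
    dotH1 v ≤ K := by
  set φ : ℕ → ℝ → ℂ := fun n k => ((((n : ℝ) + 1) : ℝ) : ℂ) *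
    𝓕 (fun x => v (x + 1 / ((n : ℝ) + 1)) - v x) k with hφ
  have hφm : ∀ n, AEStronglyMeasurable (φ n) volume := fun n =>
    (continuous_const.mul
      (continuous_fourier (integrable_translate_sub hv _))).aestronglyMeasurable
  have hlim : ∀ k, Tendsto (fun n => φ n k) atTop
      (𝓝 (Complex.I * ((2 * Real.pi * k : ℝ) : ℂ) * 𝓕 v k)) := fun k => by
    simp only [hφ, fourier_translate_sub hv, ← mul_assoc]
    exact (tendsto_difference_quotient k).mul_const _
  -- Fatou on the Fourier side, along `h = 1/(n+1)`. The term with `K'` is of second order in `h`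
  -- and vanishes in the limit because `K'` is finite.
  have hle := Lp.eLpNorm_lim_le_liminf_eLpNorm (p := 2) hφm _ (Eventually.of_forall hlim)
  have hb : ∀ n, eLpNorm (φ n) 2 volume ≤ K + ENNReal.ofReal (1 / ((n : ℝ) + 1)) * K' := by
    intro n
    have hpos : (0 : ℝ) < (n : ℝ) + 1 := by positivity
    have h1 : eLpNorm (φ n) 2 volume = ENNReal.ofReal ((n : ℝ) + 1) *
        eLpNorm (fun x => v (x + 1 / ((n : ℝ) + 1)) - v x) 2 volume := by
      rw [← eLpNorm_fourier (integrable_translate_sub hv _) (memLp_translate_sub hv2 _)]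
      have := eLpNorm_const_smul ((((n : ℝ) + 1) : ℝ) : ℂ)
        (𝓕 (fun x => v (x + 1 / ((n : ℝ) + 1)) - v x)) 2 volume
      rw [← ofReal_norm, Complex.norm_real, Real.norm_of_nonneg hpos.le] at this
      exact this
    rw [h1]
    refine (mul_le_mul_right (hK _ (by positivity)) _).trans ?_
    rw [← mul_assoc, ← ENNReal.ofReal_mul hpos.le, mul_one_div_cancel hpos.ne']
    simp
  have hlimK : Tendsto (fun n : ℕ => K + ENNReal.ofReal (1 / ((n : ℝ) + 1)) * K') atTop
      (𝓝 (K + ENNReal.ofReal 0 * K')) :=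
    tendsto_const_nhds.add (ENNReal.Tendsto.mul_const
      (ENNReal.tendsto_ofReal tendsto_one_div_add_atTop_nhds_zero_nat) (Or.inr hK'))
  calc dotH1 v = eLpNorm (fun k : ℝ => Complex.I * ((2 * Real.pi * k : ℝ) : ℂ) * 𝓕 v k) 2 volume :=
        eLpNorm_congr_norm_ae (Eventually.of_forall fun k => by
          rw [norm_smul, norm_mul, norm_mul, Complex.norm_I, Complex.norm_real]; simp)
    _ ≤ _ := hle
    _ ≤ _ := liminf_le_liminf (Eventually.of_forall hb)
    _ = K := by rw [hlimK.liminf_eq]; simp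

/-- Splitting off `|a|²(a-b)` costs `M²`, and the remaining `(|a|²-|b|²)b` costs `2M²`. The estimate
serves both as the chain rule, with translates of `v`, and as the Lipschitz bound for the
nonlinearity on `L²`. -/
theorem norm_cubic_sub_le {a b : ℂ} {M : ℝ} (ha : ‖a‖ ≤ M) (hb : ‖b‖ ≤ M) :
    ‖‖a‖ ^ 2 • a - ‖b‖ ^ 2 • b‖ ≤ 3 * M ^ 2 * ‖a - b‖ := by
  have hM : 0 ≤ M := (norm_nonneg a).trans ha
  have e : ‖a‖ ^ 2 • a - ‖b‖ ^ 2 • b =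
      ‖a‖ ^ 2 • (a - b) + ((‖a‖ - ‖b‖) * (‖a‖ + ‖b‖)) • b := by
    rw [smul_sub, show (‖a‖ - ‖b‖) * (‖a‖ + ‖b‖) = ‖a‖ ^ 2 - ‖b‖ ^ 2 by ring, sub_smul]; abel
  have h1 : |‖a‖ - ‖b‖| ≤ ‖a - b‖ := abs_norm_sub_norm_le a b
  rw [e]
  refine (norm_add_le _ _).trans ?_
  rw [norm_smul, norm_smul, norm_mul, Real.norm_eq_abs, Real.norm_eq_abs, Real.norm_eq_abs,
    abs_of_nonneg (by positivity : (0 : ℝ) ≤ ‖a‖ ^ 2),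
    abs_of_nonneg (by positivity : (0 : ℝ) ≤ ‖a‖ + ‖b‖)]
  have h2 : ‖a‖ ^ 2 * ‖a - b‖ ≤ M ^ 2 * ‖a - b‖ := by gcongr
  have h3 : |‖a‖ - ‖b‖| * (‖a‖ + ‖b‖) * ‖b‖ ≤ ‖a - b‖ * (M + M) * M := by gcongr
  linarith

theorem memLp_cubic {v : ℝ → ℂ} {p : ℝ≥0∞} {M : ℝ} (hv : MemLp v p volume)
    (hM : ∀ᵐ x, ‖v x‖ ≤ M) : MemLp (fun x => ‖v x‖ ^ 2 • v x) p volume := by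
  refine hv.of_le_mul (c := M ^ 2) ((hv.1.norm.pow 2).smul hv.1) ?_
  filter_upwards [hM] with x hx
  rw [norm_smul, norm_pow, norm_norm]
  gcongr

theorem ae_translate {P : ℝ → Prop} (hP : ∀ᵐ x, P x) (h : ℝ) : ∀ᵐ x, P (x + h) :=
  (measurePreserving_add_right' h).quasiMeasurePreserving.ae hP

/-- The chain rule estimate `‖∂ₓ(|v|² v)‖ ≤ 3 ‖v‖_∞² ‖∂ₓ v‖`. -/
theorem dotH1_cubic_le {v : ℝ → ℂ} {M : ℝ} (hv : Integrable v) (hv2 : MemLp v 2 volume)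
    (hM : ∀ᵐ x, ‖v x‖ ≤ M) :
    dotH1 (fun x => ‖v x‖ ^ 2 • v x) ≤ ENNReal.ofReal (3 * M ^ 2) * dotH1 v := by
  have hc1 := memLp_one_iff_integrable.1 (memLp_cubic (memLp_one_iff_integrable.2 hv) hM)
  refine dotH1_le_of_translate hc1 (memLp_cubic hv2 hM) ENNReal.zero_ne_top fun h hh => ?_
  have h1 : eLpNorm (fun x => ‖v (x + h)‖ ^ 2 • v (x + h) - ‖v x‖ ^ 2 • v x) 2 volume ≤
      ENNReal.ofReal (3 * M ^ 2) * eLpNorm (fun x => v (x + h) - v x) 2 volume := by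
    refine eLpNorm_le_mul_eLpNorm_of_ae_le_mul ?_ 2
    filter_upwards [hM, ae_translate hM h] with x h1 h2
    exact norm_cubic_sub_le h2 h1
  refine h1.trans ?_
  rw [mul_zero, add_zero, mul_left_comm]
  gcongr
  simpa [abs_of_pos hh] using eLpNorm_translate_sub_le hv hv2 h

theorem norm_exp_I_sub_exp_I_le (a b : ℝ) :
    ‖Complex.exp (Complex.I * (a : ℂ)) - Complex.exp (Complex.I * (b : ℂ))‖ ≤ |a - b| := by
  have : Complex.exp (Complex.I * (a : ℂ)) - Complex.exp (Complex.I * (b : ℂ)) =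
      Complex.exp (Complex.I * (b : ℂ)) * (Complex.exp (Complex.I * ((a - b : ℝ) : ℂ)) - 1) := by
    rw [mul_sub, ← Complex.exp_add, mul_one]; congr 2; push_cast; ring
  rw [this, norm_mul, mul_comm Complex.I (b : ℂ), Complex.norm_exp_ofReal_mul_I, one_mul]
  exact Real.norm_exp_I_mul_ofReal_sub_one_le

theorem norm_chirp_translate_sub_le {t : ℝ} (ht : t ≠ 0) {h : ℝ} (hh : 0 < h) (x : ℝ) :
    ‖chirp t (x + h) - chirp t x‖ ≤ h * (|t|⁻¹ * |x| + h * (2 * |t|)⁻¹) := by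
  refine (norm_exp_I_sub_exp_I_le _ _).trans ?_
  have e : (x + h) ^ 2 / (2 * t) - x ^ 2 / (2 * t) = h * (t⁻¹ * x + h * (2 * t)⁻¹) := by
    field_simp; ring
  rw [e, abs_mul, abs_of_pos hh]
  gcongr
  refine (abs_add_le _ _).trans (le_of_eq ?_)
  rw [abs_mul, abs_mul, abs_inv, abs_inv, abs_mul, abs_two, abs_of_pos hh]

/-- Product rule: the derivative of the chirp is `i x/t` times the chirp. The quadratic remainder
`h²/(2|t|)` of the phase goes into the constant `K'` of `dotH1_le_of_translate`. This serves only to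
show that weighted norms of profiles are finite. -/
theorem dotH1_chirp_mul_le {t : ℝ} (ht : t ≠ 0) {v : ℝ → ℂ} (hv : Integrable v)
    (hv2 : MemLp v 2 volume) :
    dotH1 (fun x => chirp t x * v x) ≤
      dotH1 v + ENNReal.ofReal |t|⁻¹ * eLpNorm (fun x => |x| • v x) 2 volume := by
  have hx : AEStronglyMeasurable (fun x : ℝ => |x| • v x) volume :=
    continuous_abs.aestronglyMeasurable.smul hv2.1
  refine dotH1_le_of_translate (K' := ENNReal.ofReal (2 * |t|)⁻¹ * eLpNorm v 2 volume)
    (integrable_mul_of_norm_one (continuous_chirp t) (norm_chirp t) hv)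
    (memLp_mul_of_norm_one (continuous_chirp t) (norm_chirp t) hv2)
    (ENNReal.mul_ne_top ENNReal.ofReal_ne_top hv2.2.ne) fun h hh => ?_
  have hm1 : AEStronglyMeasurable (fun x => chirp t (x + h) * (v (x + h) - v x)) volume :=
    ((continuous_chirp t).comp (continuous_add_const h)).aestronglyMeasurable.mul
      (memLp_translate_sub hv2 h).1
  have hm2 : AEStronglyMeasurable (fun x => (chirp t (x + h) - chirp t x) * v x) volume :=
    (((continuous_chirp t).comp (continuous_add_const h)).sub
      (continuous_chirp t)).aestronglyMeasurable.mul hv2.1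
  have h1 : eLpNorm (fun x => chirp t (x + h) * (v (x + h) - v x)) 2 volume ≤
      ENNReal.ofReal h * dotH1 v := by
    rw [← abs_of_pos hh]
    refine le_trans (le_of_eq ?_) (eLpNorm_translate_sub_le hv hv2 _)
    rw [abs_of_pos hh]
    exact eLpNorm_congr_norm_ae (Eventually.of_forall fun x => by simp [norm_chirp])
  have h2 : eLpNorm (fun x => (chirp t (x + h) - chirp t x) * v x) 2 volume ≤
      ENNReal.ofReal h * (ENNReal.ofReal |t|⁻¹ * eLpNorm (fun x => |x| • v x) 2 volume +
        ENNReal.ofReal h * (ENNReal.ofReal (2 * |t|)⁻¹ * eLpNorm v 2 volume)) := by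
    have h3 : eLpNorm (fun x => (chirp t (x + h) - chirp t x) * v x) 2 volume ≤
        ENNReal.ofReal h * eLpNorm ((|t|⁻¹ : ℝ) • (fun x => |x| • ‖v x‖) +
          (h * (2 * |t|)⁻¹ : ℝ) • fun x => ‖v x‖) 2 volume := by
      refine eLpNorm_le_mul_eLpNorm_of_ae_le_mul (Eventually.of_forall fun x => ?_) 2
      rw [norm_mul]
      refine (mul_le_mul_of_nonneg_right (norm_chirp_translate_sub_le ht hh x)
        (norm_nonneg _)).trans ?_
      simp only [Pi.add_apply, Pi.smul_apply, smul_eq_mul]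
      rw [Real.norm_of_nonneg (by positivity)]
      apply le_of_eq; ring
    refine h3.trans (mul_le_mul_right ?_ _)
    have hxn : AEStronglyMeasurable (fun x : ℝ => |x| • ‖v x‖) volume :=
      continuous_abs.aestronglyMeasurable.smul hv2.1.norm
    refine (eLpNorm_add_le (hxn.const_smul _) (hv2.1.norm.const_smul _) (by norm_num)).trans ?_
    rw [eLpNorm_const_smul, eLpNorm_const_smul, Real.enorm_eq_ofReal (by positivity),
      Real.enorm_eq_ofReal (by positivity), ENNReal.ofReal_mul hh.le, ← mul_assoc, eLpNorm_norm]
    refine add_le_add_left (mul_le_mul_right (le_of_eq ?_) _) _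
    exact eLpNorm_congr_norm_ae (Eventually.of_forall fun x => by simp)
  calc eLpNorm (fun x => chirp t (x + h) * v (x + h) - chirp t x * v x) 2 volume
      = eLpNorm ((fun x => chirp t (x + h) * (v (x + h) - v x)) +
          fun x => (chirp t (x + h) - chirp t x) * v x) 2 volume := by
        congr 1; ext x; simp only [Pi.add_apply]; ring
    _ ≤ _ := eLpNorm_add_le hm1 hm2 (by norm_num)
    _ ≤ _ := add_le_add h1 h2
    _ = _ := by ring

/-! ### The weighted norm of a free evolution. -/

theorem eLpNorm_comp_div {E : Type*} [NormedAddCommGroup E] (φ : ℝ → E) {c : ℝ} (hc : c ≠ 0) :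
    eLpNorm (fun x => φ (x / c)) 2 volume =
      ENNReal.ofReal (Real.sqrt |c|) * eLpNorm φ 2 volume := by
  have hc' : c⁻¹ ≠ 0 := inv_ne_zero hc
  have e : (fun x => φ (x / c)) = φ ∘ (fun x => c⁻¹ * x) := by
    ext x; simp [div_eq_inv_mul]
  have hemb : MeasurableEmbedding (fun x : ℝ => c⁻¹ * x) :=
    (Homeomorph.mulLeft₀ c⁻¹ hc').measurableEmbedding
  rw [e, ← hemb.eLpNorm_map_measure, Real.map_volume_mul_left hc', inv_inv,
    eLpNorm_smul_measure_of_ne_top (by norm_num)]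
  rw [Real.sqrt_eq_rpow, ENNReal.ofReal_rpow_of_nonneg (abs_nonneg c) (by norm_num)]
  simp

/-- The weighted norm of a free evolution is a derivative norm after removing the chirp. -/
theorem normHdot01_freeGroup {t : ℝ} (ht : t ≠ 0) (f : L2) (hf : Integrable f) :
    normHdot01 (freeGroup t f) = ENNReal.ofReal |t| * dotH1 (fun y => chirp t y * f y) := by
  have hc : (2 * Real.pi * t) ≠ 0 := by simp [ht, Real.pi_ne_zero]
  have hpos : 0 < 2 * Real.pi * |t| := by have := Real.pi_pos; positivity
  have habs : |2 * Real.pi * t| = 2 * Real.pi * |t| := by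
    rw [abs_mul, abs_of_pos (by positivity : (0 : ℝ) < 2 * Real.pi)]
  set φ : ℝ → ℂ := fun k => |2 * Real.pi * k| • 𝓕 (fun y => chirp t y * f y) k with hφ
  -- At the frequency `k = x/(2πt)` the weight `|x|` equals `|t|·|2πk|`. The dilation then
  -- contributes `√(2π|t|)`, which cancels the modulus of `kernelConst t`.
  have h1 : normHdot01 (freeGroup t f) =
      eLpNorm (((|t| * ‖kernelConst t‖ : ℝ)) • fun x => φ (x / (2 * Real.pi * t))) 2 volume := by
    refine eLpNorm_congr_norm_ae ?_
    filter_upwards [freeGroup_ae_eq ht f hf] with x hx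
    rw [hx]
    simp only [Pi.smul_apply, hφ, norm_smul, norm_mul, norm_chirp, mul_one,
      Real.norm_eq_abs, abs_abs]
    have : |2 * Real.pi * (x / (2 * Real.pi * t))| = |x| / |t| := by
      rw [← abs_div]; congr 1
      have := Real.pi_ne_zero
      field_simp
    rw [this]
    have := abs_ne_zero.2 ht
    rw [abs_of_nonneg (norm_nonneg (kernelConst t))]
    field_simp
  rw [h1, eLpNorm_const_smul, eLpNorm_comp_div φ hc, Real.enorm_eq_ofReal (by positivity),
    ← mul_assoc, ← ENNReal.ofReal_mul (by positivity), norm_kernelConst, habs]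
  congr 2
  rw [mul_assoc, one_div_mul_cancel (Real.sqrt_pos.2 hpos).ne', mul_one]

/-! ### Bounded multipliers and the unitary group on `L²`. -/

theorem memLp_bdd_mul {m : ℝ → ℂ} (hm : AEStronglyMeasurable m volume) {C : ℝ}
    (hb : ∀ x, ‖m x‖ ≤ C) (g : L2) : MemLp (fun x => m x * g x) 2 volume :=
  (Lp.memLp g).of_le_mul (c := C) (hm.mul (Lp.aestronglyMeasurable g))
    (Eventually.of_forall fun x => by rw [norm_mul]; gcongr; exact hb x)

/-- Multiplication by a bounded function as an operator on `L²`. -/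
def mulCLM (m : ℝ → ℂ) (hm : AEStronglyMeasurable m volume) (C : ℝ) (hb : ∀ x, ‖m x‖ ≤ C) :
    L2 →L[ℂ] L2 :=
  LinearMap.mkContinuous
    { toFun := fun g => (memLp_bdd_mul hm hb g).toLp _
      map_add' := fun f g => by
        apply Lp.ext
        filter_upwards [(memLp_bdd_mul hm hb (f + g)).coeFn_toLp, (memLp_bdd_mul hm hb f).coeFn_toLp,
          (memLp_bdd_mul hm hb g).coeFn_toLp, Lp.coeFn_add f g,
          Lp.coeFn_add ((memLp_bdd_mul hm hb f).toLp _) ((memLp_bdd_mul hm hb g).toLp _)]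
          with x h1 h2 h3 h4 h5
        rw [h1, h5, Pi.add_apply, h2, h3, h4, Pi.add_apply, mul_add]
      map_smul' := fun c g => by
        apply Lp.ext
        filter_upwards [(memLp_bdd_mul hm hb (c • g)).coeFn_toLp, (memLp_bdd_mul hm hb g).coeFn_toLp,
          Lp.coeFn_smul c g, Lp.coeFn_smul c ((memLp_bdd_mul hm hb g).toLp _)] with x h1 h2 h3 h4
        rw [h1, RingHom.id_apply, h4, Pi.smul_apply, h2, h3, Pi.smul_apply, smul_eq_mul,
          smul_eq_mul, mul_left_comm] }
    C fun g => by
      refine Lp.norm_le_mul_norm_of_ae_le_mul ?_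
      filter_upwards [(memLp_bdd_mul hm hb g).coeFn_toLp] with x hx
      simp only [LinearMap.coe_mk, AddHom.coe_mk]
      rw [hx, norm_mul]
      gcongr
      exact hb x

theorem mulCLM_ae_eq {m : ℝ → ℂ} (hm : AEStronglyMeasurable m volume) {C : ℝ}
    (hb : ∀ x, ‖m x‖ ≤ C) (g : L2) : mulCLM m hm C hb g =ᵐ[volume] fun x => m x * g x :=
  (memLp_bdd_mul hm hb g).coeFn_toLp

theorem freeGroup_eq_mulCLM (t : ℝ) (g : L2) :
    freeGroup t g = 𝓕⁻ (mulCLM (schrodingerSymbol t)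
      (continuous_schrodingerSymbol t).aestronglyMeasurable 1
      (fun k => (norm_schrodingerSymbol t k).le) (𝓕 g)) := rfl

theorem fourier_freeGroup_ae_eq (t : ℝ) (g : L2) :
    (𝓕 (freeGroup t g) : L2) =ᵐ[volume] fun k => schrodingerSymbol t k * (𝓕 g : L2) k := by
  rw [freeGroup, FourierTransform.fourier_fourierInv_eq]
  exact (memLp_schrodingerSymbol_mul t (𝓕 g)).coeFn_toLp

theorem norm_freeGroup (t : ℝ) (g : L2) : ‖freeGroup t g‖ = ‖g‖ := by
  rw [← Lp.norm_fourier_eq (freeGroup t g), ← Lp.norm_fourier_eq g, Lp.norm_def, Lp.norm_def]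
  congr 1
  refine eLpNorm_congr_norm_ae ?_
  filter_upwards [fourier_freeGroup_ae_eq t g] with k hk
  rw [hk, norm_mul, norm_schrodingerSymbol, one_mul]

/-- The free Schroedinger group as a linear isometry of `L²`. -/
def freeGroupIsometry (t : ℝ) : L2 →ₗᵢ[ℂ] L2 where
  toFun := freeGroup t
  map_add' f g := by
    simp only [freeGroup_eq_mulCLM, FourierTransform.fourier_add, map_add,
      FourierTransform.fourierInv_add]
  map_smul' c g := by
    simp only [freeGroup_eq_mulCLM, FourierTransform.fourier_smul, map_smul,
      FourierTransform.fourierInv_smul, RingHom.id_apply]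
  norm_map' := norm_freeGroup t

@[simp]
theorem freeGroupIsometry_apply (t : ℝ) (g : L2) : freeGroupIsometry t g = freeGroup t g := rfl

theorem fourier_injective {f g : L2} (h : (𝓕 f : L2) = 𝓕 g) : f = g :=
  (Lp.fourierTransformₗᵢ ℝ ℂ).injective h

theorem freeGroup_freeGroup (s t : ℝ) (g : L2) :
    freeGroup s (freeGroup t g) = freeGroup (s + t) g := by
  apply fourier_injective
  apply Lp.ext
  filter_upwards [fourier_freeGroup_ae_eq s (freeGroup t g), fourier_freeGroup_ae_eq t g,
    fourier_freeGroup_ae_eq (s + t) g] with k h1 h2 h3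
  rw [h1, h2, h3, ← mul_assoc]
  congr 1
  simp only [schrodingerSymbol, ← Complex.exp_add]
  congr 1; push_cast; ring

theorem freeGroup_zero (g : L2) : freeGroup 0 g = g := by
  apply fourier_injective
  apply Lp.ext
  filter_upwards [fourier_freeGroup_ae_eq 0 g] with k h1
  rw [h1]; simp [schrodingerSymbol]

theorem freeGroup_sub (t : ℝ) (f g : L2) : freeGroup t (f - g) = freeGroup t f - freeGroup t g :=
  map_sub (freeGroupIsometry t) f g

theorem normHdot10_freeGroup (t : ℝ) (g : L2) : normHdot10 (freeGroup t g) = normHdot10 g := by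
  refine eLpNorm_congr_norm_ae ?_
  filter_upwards [fourier_freeGroup_ae_eq t g] with k hk
  rw [hk, norm_smul, norm_smul, norm_mul, norm_schrodingerSymbol, one_mul]

theorem continuous_freeGroup (g : L2) : Continuous fun t => freeGroup t g := by
  have hcont : Continuous (fun g : L2 => (𝓕⁻ g : L2)) :=
    (Lp.fourierTransformₗᵢ ℝ ℂ).symm.continuous
  refine hcont.comp (continuous_iff_continuousAt.2 fun t₀ => ?_)
  rw [ContinuousAt, Lp.tendsto_Lp_iff_tendsto_eLpNorm']
  have hd := tendsto_eLpNorm_mul_sub (l := 𝓝 t₀) (m := schrodingerSymbol)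
    (m₀ := schrodingerSymbol t₀) (Lp.memLp (𝓕 g : L2))
    (fun t => (continuous_schrodingerSymbol t).aestronglyMeasurable)
    (continuous_schrodingerSymbol t₀).aestronglyMeasurable
    (fun t k => (norm_schrodingerSymbol t k).le) (fun k => (norm_schrodingerSymbol t₀ k).le)
    (fun k => by
      have : Continuous fun t => schrodingerSymbol t k := by unfold schrodingerSymbol; fun_prop
      exact this.tendsto t₀)
  refine hd.congr fun t => eLpNorm_congr_ae ?_
  filter_upwards [(memLp_schrodingerSymbol_mul t (𝓕 g)).coeFn_toLp,
    (memLp_schrodingerSymbol_mul t₀ (𝓕 g)).coeFn_toLp] with k h1 h2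
  simp only [Pi.sub_apply]
  rw [h1, h2]

/-- The group is only strongly continuous in time. The vector is therefore frozen while time moves,
and the error from moving the vector is controlled uniformly by the isometry property. -/
theorem continuousOn_freeGroup_comp {S : Set ℝ} {θ : ℝ → ℝ} (hθ : ContinuousOn θ S) {G : ℝ → L2}
    (hG : ContinuousOn G S) : ContinuousOn (fun s => freeGroup (θ s) (G s)) S := by
  intro s₀ hs₀
  have h1 : Tendsto (fun s => freeGroup (θ s) (G s₀) - freeGroup (θ s₀) (G s₀)) (𝓝[S] s₀) (𝓝 0) := by
    have := ((continuous_freeGroup (G s₀)).tendsto (θ s₀)).comp (hθ s₀ hs₀)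
    simpa using this.sub_const (freeGroup (θ s₀) (G s₀))
  have h2 : Tendsto (fun s => freeGroup (θ s) (G s - G s₀)) (𝓝[S] s₀) (𝓝 0) := by
    rw [tendsto_zero_iff_norm_tendsto_zero]
    simp only [norm_freeGroup]
    rw [← tendsto_zero_iff_norm_tendsto_zero]
    simpa using (hG s₀ hs₀).tendsto.sub_const (G s₀)
  have h3 := (h2.add h1).add_const (freeGroup (θ s₀) (G s₀))
  rw [add_zero, zero_add] at h3
  refine h3.congr fun s => ?_
  rw [freeGroup_sub]; abel

/-! ### Weighted norms of integrals, sums and multiples. -/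

/-- Minkowski's integral inequality for weighted `L²` norms. -/
theorem eLpNorm_weight_integral_le {m : ℝ → ℝ} (hm : Measurable m) {F : ℝ → L2} {a b : ℝ}
    (hab : a ≤ b) (hF : IntervalIntegrable F volume a b) {g : ℝ → ℝ≥0∞}
    (hg : ∀ᵐ s ∂volume.restrict (Icc a b), eLpNorm (fun x => m x • F s x) 2 volume ≤ g s) :
    eLpNorm (fun x => m x • (∫ s in a..b, F s : L2) x) 2 volume ≤ ∫⁻ s in Icc a b, g s := by
  set I : L2 := ∫ s in a..b, F s with hI
  -- The unbounded weight is truncated to zero where it exceeds `n`: each truncation is a bounded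
  -- operator and commutes with the integral, and Fatou restores the full weight.
  set μ : ℕ → ℝ → ℂ := fun n x => ((if |m x| ≤ n then m x else 0 : ℝ) : ℂ) with hμ
  have hμm : ∀ n, Measurable (μ n) := fun n =>
    Complex.measurable_ofReal.comp
      (Measurable.ite (measurableSet_le hm.norm measurable_const) hm measurable_const)
  have hμb : ∀ n x, ‖μ n x‖ ≤ n := by
    intro n x
    simp only [hμ, Complex.norm_real, Real.norm_eq_abs]
    split_ifs with h
    · exact h
    · simp
  have hμle : ∀ n x, ‖μ n x‖ ≤ |m x| := by
    intro n x
    simp only [hμ, Complex.norm_real, Real.norm_eq_abs]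
    split_ifs with h
    · exact le_rfl
    · simp
  have hbound : ∀ n, eLpNorm (fun x => μ n x * I x) 2 volume ≤ ∫⁻ s in Icc a b, g s := by
    intro n
    set A := mulCLM (μ n) (hμm n).aestronglyMeasurable n (hμb n)
    have h1 : eLpNorm (fun x => μ n x * I x) 2 volume = ‖A I‖ₑ := by
      rw [← eLpNorm_congr_ae (mulCLM_ae_eq (hμm n).aestronglyMeasurable (hμb n) I), eLpNorm_coeFn]
    rw [h1, hI, ← A.intervalIntegral_comp_comm hF, intervalIntegral.integral_of_le hab]
    refine (enorm_integral_le_lintegral_enorm _).trans ?_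
    rw [restrict_Ioc_eq_restrict_Icc]
    refine lintegral_mono_ae ?_
    filter_upwards [hg] with s hs
    refine le_trans ?_ hs
    rw [← eLpNorm_coeFn, eLpNorm_congr_ae (mulCLM_ae_eq (hμm n).aestronglyMeasurable (hμb n) (F s))]
    refine eLpNorm_mono_ae (Eventually.of_forall fun x => ?_)
    rw [norm_mul, norm_smul]
    exact mul_le_mul_of_nonneg_right (hμle n x) (norm_nonneg _)
  have hlim : ∀ x, Tendsto (fun n => μ n x * I x) atTop (𝓝 (m x * I x)) := by
    intro x
    refine Tendsto.mul_const _ (tendsto_const_nhds.congr' ?_)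
    obtain ⟨N, hN⟩ := exists_nat_ge |m x|
    filter_upwards [eventually_ge_atTop N] with n hn
    have : |m x| ≤ n := hN.trans (by exact_mod_cast hn)
    simp [hμ, this]
  have hle := Lp.eLpNorm_lim_le_liminf_eLpNorm (p := 2)
    (fun n => (hμm n).aestronglyMeasurable.mul (Lp.aestronglyMeasurable I)) _
    (Eventually.of_forall hlim)
  have : (fun x => m x • I x) = fun x => (m x : ℂ) * I x := by ext x; simp
  rw [this]
  refine hle.trans ((liminf_le_liminf (Eventually.of_forall hbound)).trans ?_)
  simp

theorem normHdot01_integral_le {F : ℝ → L2} {a b : ℝ} (hab : a ≤ b)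
    (hF : IntervalIntegrable F volume a b) {g : ℝ → ℝ≥0∞}
    (hg : ∀ᵐ s ∂volume.restrict (Icc a b), normHdot01 (F s) ≤ g s) :
    normHdot01 (∫ s in a..b, F s) ≤ ∫⁻ s in Icc a b, g s :=
  eLpNorm_weight_integral_le continuous_abs.measurable hab hF hg

theorem normHdot10_integral_le {F : ℝ → L2} {a b : ℝ} (hab : a ≤ b)
    (hF : IntervalIntegrable F volume a b) {g : ℝ → ℝ≥0∞}
    (hg : ∀ᵐ s ∂volume.restrict (Icc a b), normHdot10 (F s) ≤ g s) :
    normHdot10 (∫ s in a..b, F s) ≤ ∫⁻ s in Icc a b, g s := by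
  let A : L2 →L[ℂ] L2 := (Lp.fourierTransformₗᵢ ℝ ℂ).toContinuousLinearEquiv
  have hA : ∀ f : L2, A f = 𝓕 f := fun f => rfl
  have hF' : IntervalIntegrable (fun s => (𝓕 (F s) : L2)) volume a b :=
    ⟨A.integrable_comp hF.1, A.integrable_comp hF.2⟩
  have h1 : (𝓕 (∫ s in a..b, F s : L2) : L2) = ∫ s in a..b, 𝓕 (F s) :=
    (A.intervalIntegral_comp_comm hF).symm
  rw [normHdot10, h1]
  exact eLpNorm_weight_integral_le (m := fun k => |2 * Real.pi * k|)
    (by fun_prop : Continuous _).measurable hab hF' hg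

theorem normHdot10_sub_le (f g : L2) : normHdot10 (f - g) ≤ normHdot10 f + normHdot10 g := by
  have e : (𝓕 (f - g) : L2) = 𝓕 f - 𝓕 g := map_sub (Lp.fourierTransformₗᵢ ℝ ℂ) f g
  unfold normHdot10
  rw [e]
  have hm : ∀ h : L2, AEStronglyMeasurable (fun k : ℝ => |2 * Real.pi * k| • h k) volume :=
    fun h => (by fun_prop : Continuous fun k : ℝ => |2 * Real.pi * k|).aestronglyMeasurable.smul
      (Lp.aestronglyMeasurable h)
  refine le_trans (le_of_eq (eLpNorm_congr_ae ?_)) (eLpNorm_sub_le (hm _) (hm _) (by norm_num))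
  filter_upwards [Lp.coeFn_sub (𝓕 f : L2) (𝓕 g)] with k hk
  rw [hk, Pi.sub_apply, smul_sub]; rfl

theorem normHdot01_sub_le (f g : L2) : normHdot01 (f - g) ≤ normHdot01 f + normHdot01 g := by
  unfold normHdot01
  have hm : ∀ h : L2, AEStronglyMeasurable (fun k : ℝ => |k| • h k) volume :=
    fun h => continuous_abs.aestronglyMeasurable.smul (Lp.aestronglyMeasurable h)
  refine le_trans (le_of_eq (eLpNorm_congr_ae ?_)) (eLpNorm_sub_le (hm _) (hm _) (by norm_num))
  filter_upwards [Lp.coeFn_sub f g] with k hk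
  rw [hk, Pi.sub_apply, smul_sub]; rfl

theorem normHdot10_smul (c : ℂ) (f : L2) : normHdot10 (c • f) = ‖c‖ₑ * normHdot10 f := by
  have e : (𝓕 (c • f) : L2) = c • 𝓕 f := map_smul (Lp.fourierTransformₗᵢ ℝ ℂ) c f
  unfold normHdot10
  rw [e, ← eLpNorm_const_smul]
  refine eLpNorm_congr_ae ?_
  filter_upwards [Lp.coeFn_smul c (𝓕 f : L2)] with k hk
  rw [hk, Pi.smul_apply, Pi.smul_apply, smul_comm]

theorem normHdot01_smul (c : ℂ) (f : L2) : normHdot01 (c • f) = ‖c‖ₑ * normHdot01 f := by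
  unfold normHdot01
  rw [← eLpNorm_const_smul]
  refine eLpNorm_congr_ae ?_
  filter_upwards [Lp.coeFn_smul c f] with k hk
  rw [hk, Pi.smul_apply, Pi.smul_apply, smul_comm]

/-! ### Weighted Cauchy–Schwarz and the `t^{-1/4}` error. -/

theorem lintegral_inv_sq_add {t : ℝ} (ht : 0 < t) :
    ∫⁻ x : ℝ, ENNReal.ofReal ((x ^ 2 + t)⁻¹) = ENNReal.ofReal (Real.pi / Real.sqrt t) := by
  have hs : 0 < Real.sqrt t := Real.sqrt_pos.2 ht
  have e : (fun x : ℝ => (x ^ 2 + t)⁻¹) = fun x => t⁻¹ * (1 + (x / Real.sqrt t) ^ 2)⁻¹ := by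
    ext x
    rw [div_pow, Real.sq_sqrt ht.le]
    field_simp
    ring
  have hint : Integrable fun x : ℝ => (x ^ 2 + t)⁻¹ := by
    rw [e]
    exact (integrable_inv_one_add_sq.comp_div hs.ne').const_mul _
  rw [← ofReal_integral_eq_lintegral_ofReal hint
    (Eventually.of_forall fun x => by simp only [Pi.zero_apply]; positivity), e,
    integral_const_mul, Measure.integral_comp_div (fun x : ℝ => (1 + x ^ 2)⁻¹),
    integral_univ_inv_one_add_sq, abs_of_pos hs, smul_eq_mul]
  congr 1
  nth_rewrite 1 [← Real.sq_sqrt ht.le]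
  field_simp

/-- Cauchy–Schwarz against `(x²+t)^{-1/2}`, whose `L²` norm is `√π t^{-1/4}`. At `t = 1` it bounds
the `L¹` norm; for general `t` it is the source of the decay in `decayConst`. -/
theorem lintegral_inv_sqrt_mul_le {t : ℝ} (ht : 0 < t) {g : ℝ → ℝ≥0∞}
    (hg : AEMeasurable g volume) :
    ∫⁻ x : ℝ, ENNReal.ofReal ((Real.sqrt (x ^ 2 + t))⁻¹) * g x ≤
      ENNReal.ofReal (Real.sqrt (Real.pi / Real.sqrt t)) * (∫⁻ x, g x ^ 2) ^ (1 / 2 : ℝ) := by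
  have hm : Measurable fun x : ℝ => ENNReal.ofReal ((Real.sqrt (x ^ 2 + t))⁻¹) := by fun_prop
  have h := ENNReal.lintegral_mul_le_Lp_mul_Lq volume Real.HolderConjugate.two_two
    hm.aemeasurable hg
  refine h.trans ?_
  simp only [ENNReal.rpow_two]
  gcongr
  apply le_of_eq
  have : ∀ x : ℝ, ENNReal.ofReal ((Real.sqrt (x ^ 2 + t))⁻¹) ^ 2 =
      ENNReal.ofReal ((x ^ 2 + t)⁻¹) := by
    intro x
    rw [← ENNReal.ofReal_pow (by positivity), inv_pow, Real.sq_sqrt (by positivity)]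
  simp only [this]
  rw [lintegral_inv_sq_add ht, Real.sqrt_eq_rpow (Real.pi / Real.sqrt t),
    ENNReal.ofReal_rpow_of_nonneg (by have := Real.pi_pos; positivity) (by norm_num)]

/-- The `L¹` norm is controlled by the weighted `L²` norm. -/
theorem eLpNorm_one_le_normH01 (g : L2) :
    eLpNorm g 1 volume ≤ ENNReal.ofReal (Real.sqrt Real.pi) * normH01 g := by
  rw [eLpNorm_one_eq_lintegral_enorm, normH01, eLpNorm_two_eq]
  have hm : AEStronglyMeasurable (fun x : ℝ => Real.sqrt (1 + x ^ 2) • g x) volume :=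
    (by fun_prop : Continuous fun x : ℝ => Real.sqrt (1 + x ^ 2)).aestronglyMeasurable.smul
      (Lp.aestronglyMeasurable g)
  have h := lintegral_inv_sqrt_mul_le one_pos hm.enorm
  simp only [Real.sqrt_one, div_one] at h
  refine le_trans (le_of_eq (lintegral_congr fun x => ?_)) h
  rw [enorm_smul, ← mul_assoc, Real.enorm_eq_ofReal (by positivity),
    ← ENNReal.ofReal_mul (by positivity), add_comm, inv_mul_cancel₀ (by positivity)]
  simp

theorem eLpNorm_le_normH01 (g : L2) : eLpNorm g 2 volume ≤ normH01 g := by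
  refine eLpNorm_mono_ae (Eventually.of_forall fun x => ?_)
  rw [norm_smul, Real.norm_of_nonneg (by positivity)]
  refine le_mul_of_one_le_left (norm_nonneg _) ?_
  rw [Real.one_le_sqrt]; nlinarith [sq_nonneg x]

theorem normHdot01_le_normH01 (g : L2) : normHdot01 g ≤ normH01 g := by
  refine eLpNorm_mono_ae (Eventually.of_forall fun x => ?_)
  rw [norm_smul, norm_smul, Real.norm_of_nonneg (by positivity), Real.norm_of_nonneg (by positivity)]
  refine mul_le_mul_of_nonneg_right (Real.abs_le_sqrt ?_) (norm_nonneg _)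
  linarith

theorem normHdot10_le_normH10 (g : L2) : normHdot10 g ≤ normH10 g := by
  refine eLpNorm_mono_ae (Eventually.of_forall fun x => ?_)
  rw [norm_smul, norm_smul, Real.norm_of_nonneg (by positivity), Real.norm_of_nonneg (by positivity)]
  refine mul_le_mul_of_nonneg_right (Real.abs_le_sqrt ?_) (norm_nonneg _)
  linarith

theorem normH01_le (g : L2) : normH01 g ≤ ‖g‖ₑ + normHdot01 g := by
  have hm : AEStronglyMeasurable (fun x : ℝ => |x| • g x) volume :=
    continuous_abs.aestronglyMeasurable.smul (Lp.aestronglyMeasurable g)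
  have h := eLpNorm_add_le (p := 2) (Lp.aestronglyMeasurable g).norm hm.norm (by norm_num)
  rw [eLpNorm_norm, eLpNorm_norm, eLpNorm_coeFn] at h
  refine le_trans (eLpNorm_mono_ae (Eventually.of_forall fun x => ?_)) h
  rw [norm_smul, Real.norm_of_nonneg (by positivity), Pi.add_apply, norm_smul,
    Real.norm_of_nonneg (abs_nonneg x), Real.norm_of_nonneg (by positivity)]
  have : Real.sqrt (1 + x ^ 2) ≤ 1 + |x| := by
    rw [Real.sqrt_le_left (by positivity)]
    nlinarith [sq_abs x, abs_nonneg x]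
  nlinarith [norm_nonneg (g x)]

theorem integrable_of_normHdot01 {g : L2} (h : normHdot01 g ≠ ∞) : Integrable g := by
  refine memLp_one_iff_integrable.1 ⟨Lp.aestronglyMeasurable g, ?_⟩
  refine (eLpNorm_one_le_normH01 g).trans_lt (ENNReal.mul_lt_top ENNReal.ofReal_lt_top ?_)
  refine (normH01_le g).trans_lt (ENNReal.add_lt_top.2 ⟨enorm_lt_top, h.lt_top⟩)

/-- The constant in the comparison of localised and unlocalised Fourier integrals. -/
def decayConst (t : ℝ) : ℝ := 3 * Real.sqrt (Real.pi / Real.sqrt t)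

theorem decayConst_nonneg (t : ℝ) : 0 ≤ decayConst t := by unfold decayConst; positivity

/-- Fourier integrals are insensitive to factors that are close to `1` for `x² ≪ t`. -/
theorem enorm_fourier_mul_sub_le {m : ℝ → ℂ} {f : L2} {t : ℝ} (ht : 0 < t)
    (hm : AEStronglyMeasurable m volume) (hm1 : ∀ x, ‖m x - 1‖ ≤ 3 * x ^ 2 / (x ^ 2 + t))
    (hf : Integrable f) (k : ℝ) :
    ‖𝓕 (fun x => m x * f x) k - 𝓕 (f : ℝ → ℂ) k‖ₑ ≤
      ENNReal.ofReal (decayConst t) * normHdot01 f := by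
  have hmb : ∀ x, ‖m x‖ ≤ 4 := by
    intro x
    have h1 : 3 * x ^ 2 / (x ^ 2 + t) ≤ 3 := by
      rw [div_le_iff₀ (by positivity)]; nlinarith
    have h2 := norm_add_le (m x - 1) 1
    rw [sub_add_cancel, norm_one] at h2
    linarith [hm1 x]
  have hmf : Integrable fun x => m x * f x := hf.bdd_mul (c := 4) hm (Eventually.of_forall hmb)
  have hxf : AEStronglyMeasurable (fun x : ℝ => |x| • f x) volume :=
    continuous_abs.aestronglyMeasurable.smul (Lp.aestronglyMeasurable f)
  simp only [Real.fourier_real_eq_integral_exp_smul, smul_eq_mul]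
  rw [← integral_sub
    (integrable_mul_of_norm_one (by fun_prop) (fun x => Complex.norm_exp_ofReal_mul_I _) hmf)
    (integrable_mul_of_norm_one (by fun_prop) (fun x => Complex.norm_exp_ofReal_mul_I _) hf)]
  refine (enorm_integral_le_lintegral_enorm _).trans ?_
  have h := lintegral_inv_sqrt_mul_le ht hxf.enorm
  rw [← eLpNorm_two_eq] at h
  calc ∫⁻ x : ℝ, ‖Complex.exp (↑(-2 * Real.pi * x * k) * Complex.I) * (m x * f x) -
        Complex.exp (↑(-2 * Real.pi * x * k) * Complex.I) * f x‖ₑ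
      ≤ ∫⁻ x : ℝ, ENNReal.ofReal 3 *
        (ENNReal.ofReal ((Real.sqrt (x ^ 2 + t))⁻¹) * ‖|x| • f x‖ₑ) := by
        refine lintegral_mono fun x => ?_
        have e : Complex.exp (↑(-2 * Real.pi * x * k) * Complex.I) * (m x * f x) -
          Complex.exp (↑(-2 * Real.pi * x * k) * Complex.I) * f x =
          Complex.exp (↑(-2 * Real.pi * x * k) * Complex.I) * ((m x - 1) * f x) := by ring
        simp only [e]
        rw [← ofReal_norm, ← ofReal_norm, ← ENNReal.ofReal_mul (by positivity),
          ← ENNReal.ofReal_mul (by positivity)]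
        refine ENNReal.ofReal_le_ofReal ?_
        rw [norm_mul, Complex.norm_exp_ofReal_mul_I, one_mul, norm_mul, norm_smul,
          Real.norm_of_nonneg (abs_nonneg x), ← mul_assoc, ← mul_assoc]
        -- One factor `|x| ≤ √(x²+t)` is spent, leaving `3|x|/√(x²+t)`; the surviving `|x|` belongs
        -- to the weighted norm.
        refine mul_le_mul_of_nonneg_right ((hm1 x).trans ?_) (norm_nonneg _)
        have hp : 0 < x ^ 2 + t := by positivity
        have hsq : 0 < Real.sqrt (x ^ 2 + t) := Real.sqrt_pos.2 hp
        have hx : |x| ≤ Real.sqrt (x ^ 2 + t) := Real.abs_le_sqrt (by linarith)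
        rw [div_le_iff₀ hp]
        nth_rewrite 2 [← Real.sq_sqrt hp.le]
        field_simp
        nlinarith [sq_abs x, mul_le_mul_of_nonneg_right hx (abs_nonneg x)]
    _ ≤ _ := by
        rw [lintegral_const_mul' _ _ ENNReal.ofReal_ne_top, decayConst,
          ENNReal.ofReal_mul (by norm_num), mul_assoc]
        exact mul_le_mul_right h _

/-- The linear bound `x²/(2t)` and the trivial bound `2` are both below the right side on their side
of the threshold `x² = 5t`. -/
theorem norm_chirp_sub_one_le {t : ℝ} (ht : 0 < t) (x : ℝ) :
    ‖chirp t x - 1‖ ≤ 3 * x ^ 2 / (x ^ 2 + t) := by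
  have h1 : ‖chirp t x - 1‖ ≤ x ^ 2 / (2 * t) := by
    refine Real.norm_exp_I_mul_ofReal_sub_one_le.trans (le_of_eq ?_)
    rw [Real.norm_of_nonneg (by positivity)]
  have h2 : ‖chirp t x - 1‖ ≤ 2 := by
    refine (norm_sub_le _ _).trans ?_
    rw [norm_chirp, norm_one]; norm_num
  rcases le_total (x ^ 2) (5 * t) with h | h
  · refine h1.trans ?_
    rw [div_le_div_iff₀ (by positivity) (by positivity)]
    nlinarith [sq_nonneg x]
  · refine h2.trans ?_
    rw [le_div_iff₀ (by positivity)]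
    linarith

theorem enorm_fourier_chirp_sub_le {f : L2} {t : ℝ} (ht : 0 < t) (hf : Integrable f) (k : ℝ) :
    ‖𝓕 (fun x => chirp t x * f x) k - 𝓕 (f : ℝ → ℂ) k‖ₑ ≤
      ENNReal.ofReal (decayConst t) * normHdot01 f :=
  enorm_fourier_mul_sub_le ht (continuous_chirp t).aestronglyMeasurable
    (norm_chirp_sub_one_le ht) hf k

/-- The sharp cutoff to `|x| ≤ R`. -/
def cutoff (R : ℝ) : ℝ → ℂ := indicator (Icc (-R) R) 1

theorem measurable_cutoff (R : ℝ) : Measurable (cutoff R) :=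
  measurable_one.indicator measurableSet_Icc

theorem norm_cutoff_sub_one_le {R : ℝ} (hR : 0 < R) (x : ℝ) :
    ‖cutoff R x - 1‖ ≤ 3 * x ^ 2 / (x ^ 2 + R ^ 2) := by
  by_cases hx : x ∈ Icc (-R) R
  · simp only [cutoff, indicator_of_mem hx, Pi.one_apply, sub_self, norm_zero]; positivity
  · simp only [cutoff, indicator_of_notMem hx, zero_sub, norm_neg, norm_one]
    have : R < |x| := by
      rw [mem_Icc, ← abs_le] at hx; exact not_le.1 hx
    rw [le_div_iff₀ (by positivity)]
    nlinarith [sq_abs x]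

theorem memLp_cutoff_mul_exp (R k : ℝ) : MemLp (fun x : ℝ => cutoff R x *
    Complex.exp (↑(2 * Real.pi * x * k) * Complex.I)) 2 volume := by
  have h : MemLp (cutoff R) 2 volume :=
    memLp_indicator_const 2 measurableSet_Icc (1 : ℂ) (Or.inr (by simp))
  refine h.congr_norm (h.1.mul (by fun_prop : Continuous _).aestronglyMeasurable)
    (Eventually.of_forall fun x => ?_)
  rw [norm_mul, Complex.norm_exp_ofReal_mul_I, mul_one]

/-- The Fourier transform at frequency `k` of the cut off function, as a functional on `L²`. -/
def cutoffFourier (R k : ℝ) : L2 →L[ℂ] ℂ := innerSL ℂ ((memLp_cutoff_mul_exp R k).toLp _)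

theorem cutoffFourier_apply (R k : ℝ) (f : L2) :
    cutoffFourier R k f = 𝓕 (fun x => cutoff R x * f x) k := by
  rw [cutoffFourier, innerSL_apply_apply, L2.inner_def, Real.fourier_real_eq_integral_exp_smul]
  refine integral_congr_ae ?_
  filter_upwards [(memLp_cutoff_mul_exp R k).coeFn_toLp] with x hx
  rw [hx, RCLike.inner_apply, map_mul, ← Complex.exp_conj, map_mul, Complex.conj_I,
    Complex.conj_ofReal]
  have h1 : (starRingEnd ℂ) (cutoff R x) = cutoff R x := by
    by_cases h : x ∈ Icc (-R) R <;> simp [cutoff, h]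
  rw [h1, smul_eq_mul]
  have h2 : ((2 * Real.pi * x * k : ℝ) : ℂ) * -Complex.I =
    ((-2 * Real.pi * x * k : ℝ) : ℂ) * Complex.I := by push_cast; ring
  rw [h2]; ring

theorem enorm_cutoffFourier_sub_le {f : L2} {R : ℝ} (hR : 0 < R) (hf : Integrable f) (k : ℝ) :
    ‖cutoffFourier R k f - 𝓕 (f : ℝ → ℂ) k‖ₑ ≤
      ENNReal.ofReal (decayConst (R ^ 2)) * normHdot01 f := by
  rw [cutoffFourier_apply]
  exact enorm_fourier_mul_sub_le (by positivity) (measurable_cutoff R).aestronglyMeasurable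
    (norm_cutoff_sub_one_le hR) hf k

/-! ### The cubic nonlinearity in self-similar coordinates. -/

/-- The cubic nonlinearity on functions. -/
def cube (v : ℝ → ℂ) (x : ℝ) : ℂ := ‖v x‖ ^ 2 • v x

theorem cube_mul_of_norm_one {m : ℝ → ℂ} (h1 : ∀ x, ‖m x‖ = 1) (v : ℝ → ℂ) :
    cube (fun x => m x * v x) = fun x => m x * cube v x := by
  ext x
  simp only [cube, norm_mul, h1, one_mul]
  rw [mul_smul_comm]

theorem cubic_ae_eq {v : L2} {M : ℝ} (hM : ∀ᵐ x, ‖v x‖ ≤ M) :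
    cubic v =ᵐ[volume] cube v := by
  have h : MemLp (fun x => ‖v x‖ ^ 2 • v x) 2 volume := memLp_cubic (Lp.memLp v) hM
  rw [cubic, dif_pos h]
  exact h.coeFn_toLp

theorem integrable_cube {v : ℝ → ℂ} {M : ℝ} (hv : Integrable v) (hM : ∀ᵐ x, ‖v x‖ ≤ M) :
    Integrable (cube v) :=
  memLp_one_iff_integrable.1 (memLp_cubic (memLp_one_iff_integrable.2 hv) hM)

theorem integrable_cubic {v : L2} {M : ℝ} (hv : Integrable v) (hM : ∀ᵐ x, ‖v x‖ ≤ M) :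
    Integrable (cubic v) :=
  (integrable_congr (cubic_ae_eq hM)).2 (integrable_cube hv hM)

theorem normHdot10_cubic_le {v : L2} {M : ℝ} (hv : Integrable v) (hM : ∀ᵐ x, ‖v x‖ ≤ M) :
    normHdot10 (cubic v) ≤ ENNReal.ofReal (3 * M ^ 2) * normHdot10 v := by
  rw [normHdot10_eq_dotH1 _ (integrable_cubic hv hM), normHdot10_eq_dotH1 _ hv,
    dotH1_congr (cubic_ae_eq hM)]
  exact dotH1_cubic_le hv (Lp.memLp v) hM

theorem norm_cubic_sub_cubic_le {v w : L2} {M : ℝ} (hv : ∀ᵐ x, ‖v x‖ ≤ M) (hw : ∀ᵐ x, ‖w x‖ ≤ M) :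
    ‖cubic v - cubic w‖ ≤ 3 * M ^ 2 * ‖v - w‖ := by
  refine Lp.norm_le_mul_norm_of_ae_le_mul ?_
  filter_upwards [cubic_ae_eq hv, cubic_ae_eq hw, hv, hw, Lp.coeFn_sub (cubic v) (cubic w),
    Lp.coeFn_sub v w] with x h1 h2 h3 h4 h5 h6
  rw [h5, h6, Pi.sub_apply, Pi.sub_apply, h1, h2]
  exact norm_cubic_sub_le h3 h4

/-- The pairing is `∫|v|⁴`; its reality gives conservation of mass. -/
theorem inner_cubic_im {v : L2} {M : ℝ} (hv : ∀ᵐ x, ‖v x‖ ≤ M) :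
    (inner ℂ v (cubic v)).im = 0 := by
  have h : inner ℂ v (cubic v) = ∫ x, ((‖v x‖ ^ 4 : ℝ) : ℂ) := by
    rw [L2.inner_def]
    refine integral_congr_ae ?_
    filter_upwards [cubic_ae_eq hv] with x hx
    rw [hx, cube, inner_smul_right_eq_smul, inner_self_eq_norm_sq_to_K]
    simp only [Complex.real_smul, Complex.coe_algebraMap]
    push_cast
    ring
  rw [h, integral_complex_ofReal, Complex.ofReal_im]

/-- The weighted norm of the backwards free evolution. -/
theorem normHdot01_freeGroup_neg_le {s : ℝ} (hs : 0 < s) (v : L2) (hv : Integrable v) :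
    normHdot01 (freeGroup (-s) v) ≤ ENNReal.ofReal s * normHdot10 v + normHdot01 v := by
  have hs' : -s ≠ 0 := neg_ne_zero.2 hs.ne'
  rw [normHdot01_freeGroup hs' v hv, abs_neg, abs_of_pos hs, normHdot10_eq_dotH1 _ hv]
  refine (mul_le_mul_right (dotH1_chirp_mul_le hs' hv (Lp.memLp v)) _).trans (le_of_eq ?_)
  rw [abs_neg, abs_of_pos hs, mul_add, ← mul_assoc, ← ENNReal.ofReal_mul hs.le,
    mul_inv_cancel₀ hs.ne', ENNReal.ofReal_one, one_mul]
  rfl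

/-- Gauge invariance: both sides are derivative norms of chirped functions, and the unimodular chirp
passes through the cube, so the chain rule applies to the chirped function. -/
theorem normHdot01_freeGroup_neg_cubic_le {s : ℝ} (hs : 0 < s) {v : L2} {M : ℝ}
    (hv : Integrable v) (hM : ∀ᵐ x, ‖v x‖ ≤ M) :
    normHdot01 (freeGroup (-s) (cubic v)) ≤
      ENNReal.ofReal (3 * M ^ 2) * normHdot01 (freeGroup (-s) v) := by
  have hs' : -s ≠ 0 := neg_ne_zero.2 hs.ne'
  rw [normHdot01_freeGroup hs' _ (integrable_cubic hv hM), normHdot01_freeGroup hs' v hv,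
    mul_left_comm]
  gcongr
  have h1 : (fun y => chirp (-s) y * cubic v y) =ᵐ[volume] cube (fun y => chirp (-s) y * v y) := by
    rw [cube_mul_of_norm_one (norm_chirp (-s))]
    filter_upwards [cubic_ae_eq hM] with x hx
    rw [hx]
  rw [dotH1_congr h1]
  refine dotH1_cubic_le (integrable_mul_of_norm_one (continuous_chirp _) (norm_chirp _) hv)
    (memLp_mul_of_norm_one (continuous_chirp _) (norm_chirp _) (Lp.memLp v)) ?_
  filter_upwards [hM] with x hx
  rwa [norm_mul, norm_chirp, one_mul]

/-- The Fourier transform of the chirped profile: `v` in self-similar coordinates. -/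
def chirpFourier (s : ℝ) (f : L2) : ℝ → ℂ := 𝓕 (fun x => chirp s x * f x)

theorem continuous_chirpFourier (s : ℝ) {f : L2} (hf : Integrable f) :
    Continuous (chirpFourier s f) :=
  continuous_fourier (integrable_mul_of_norm_one (continuous_chirp _) (norm_chirp _) hf)

theorem ae_eq_chirpFourier {s : ℝ} (hs : 0 < s) (v : L2) (hf : Integrable (freeGroup (-s) v)) :
    v =ᵐ[volume] fun x => kernelConst s * chirp s x *
      chirpFourier s (freeGroup (-s) v) (x / (2 * Real.pi * s)) := by
  have h := freeGroup_ae_eq hs.ne' _ hf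
  rwa [freeGroup_freeGroup, add_neg_cancel, freeGroup_zero] at h

theorem norm_kernelConst_of_pos {s : ℝ} (hs : 0 < s) :
    ‖kernelConst s‖ = 1 / Real.sqrt (2 * Real.pi * s) := by
  rw [norm_kernelConst, abs_of_pos hs]

theorem ae_norm_le_of_chirpFourier {s : ℝ} (hs : 0 < s) (v : L2)
    (hf : Integrable (freeGroup (-s) v)) {B : ℝ}
    (hB : ∀ k, ‖chirpFourier s (freeGroup (-s) v) k‖ ≤ B) :
    ∀ᵐ x, ‖v x‖ ≤ 1 / Real.sqrt (2 * Real.pi * s) * B := by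
  filter_upwards [ae_eq_chirpFourier hs v hf] with x hx
  rw [hx, norm_mul, norm_mul, norm_chirp, mul_one, norm_kernelConst_of_pos hs]
  gcongr
  exact hB _

theorem ae_comp_mul {P : ℝ → Prop} (hP : ∀ᵐ x, P x) {c : ℝ} (hc : c ≠ 0) : ∀ᵐ x, P (c * x) := by
  refine (show Measure.QuasiMeasurePreserving (fun x : ℝ => c * x) volume volume from
    ⟨measurable_const_mul c, ?_⟩).ae hP
  rw [Real.map_volume_mul_left hc]
  exact Measure.smul_absolutelyContinuous

theorem norm_chirpFourier_le {s : ℝ} (hs : 0 < s) (v : L2)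
    (hf : Integrable (freeGroup (-s) v)) {M : ℝ} (hM : ∀ᵐ x, ‖v x‖ ≤ M) (k : ℝ) :
    ‖chirpFourier s (freeGroup (-s) v) k‖ ≤ Real.sqrt (2 * Real.pi * s) * M := by
  have hc : 0 < 2 * Real.pi * s := by have := Real.pi_pos; positivity
  have hae : ∀ᵐ k, ‖chirpFourier s (freeGroup (-s) v) k‖ ≤ Real.sqrt (2 * Real.pi * s) * M := by
    have h : ∀ᵐ x, ‖chirpFourier s (freeGroup (-s) v) (x / (2 * Real.pi * s))‖ ≤
        Real.sqrt (2 * Real.pi * s) * M := by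
      filter_upwards [ae_eq_chirpFourier hs v hf, hM] with x hx hx2
      rw [hx, norm_mul, norm_mul, norm_chirp, mul_one, norm_kernelConst_of_pos hs] at hx2
      have h3 := mul_le_mul_of_nonneg_left hx2 (Real.sqrt_nonneg (2 * Real.pi * s))
      rwa [← mul_assoc, mul_one_div_cancel (Real.sqrt_pos.2 hc).ne', one_mul] at h3
    filter_upwards [ae_comp_mul h hc.ne'] with k hk
    rwa [mul_div_cancel_left₀ _ hc.ne'] at hk
  -- By continuity the bound holds on a closed set; that set has full measure, hence is dense, hence
  -- is everything.
  have hcl : IsClosed {k | ‖chirpFourier s (freeGroup (-s) v) k‖ ≤ Real.sqrt (2 * Real.pi * s) * M} :=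
    isClosed_le (continuous_chirpFourier s hf).norm continuous_const
  have hd := Measure.dense_of_ae hae
  exact hcl.closure_subset_iff.2 (Subset.refl _) (hd k)

theorem fourier_comp_div (φ : ℝ → ℂ) {c : ℝ} (hc : 0 < c) (k : ℝ) :
    𝓕 (fun x => φ (x / c)) k = c * 𝓕 φ (c * k) := by
  rw [Real.fourier_real_eq_integral_exp_smul, Real.fourier_real_eq_integral_exp_smul]
  have h := Measure.integral_comp_div
    (fun x : ℝ => Complex.exp (↑(-2 * Real.pi * x * (c * k)) * Complex.I) • φ x) c
  rw [abs_of_pos hc, Complex.real_smul] at h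
  rw [← h]
  refine integral_congr_ae (Eventually.of_forall fun x => ?_)
  have : -2 * Real.pi * (x / c) * (c * k) = -2 * Real.pi * x * k := by field_simp
  simp only [this]

/-- Inverting the factorisation shows that `w` inherits integrability from `v` and boundedness from
its sup norm. Integrability of the cube is what Fourier inversion requires. -/
theorem integrable_cube_chirpFourier {s : ℝ} (hs : 0 < s) {v : L2} {M : ℝ}
    (hv : Integrable v) (hM : ∀ᵐ x, ‖v x‖ ≤ M) (hf : Integrable (freeGroup (-s) v)) :
    Integrable (cube (chirpFourier s (freeGroup (-s) v))) := by
  have hc : 0 < 2 * Real.pi * s := by have := Real.pi_pos; positivity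
  set w := chirpFourier s (freeGroup (-s) v) with hw
  have hcont : Continuous w := continuous_chirpFourier s hf
  have hκ : ‖kernelConst s‖ ≠ 0 := by
    rw [norm_kernelConst_of_pos hs]
    exact (one_div_pos.2 (Real.sqrt_pos.2 hc)).ne'
  have hwc : Integrable fun x => w (x / (2 * Real.pi * s)) := by
    have h1 : Integrable fun x => (kernelConst s)⁻¹ * (chirp (-s) x * v x) :=
      (integrable_mul_of_norm_one (continuous_chirp _) (norm_chirp _) hv).const_mul _
    refine (integrable_congr ?_).1 h1
    filter_upwards [ae_eq_chirpFourier hs v hf] with x hx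
    rw [hx, ← hw]
    have h2 := chirp_neg_time_mul s x
    have h3 : kernelConst s ≠ 0 := norm_ne_zero_iff.1 hκ
    calc _ = (kernelConst s)⁻¹ * kernelConst s * (chirp (-s) x * chirp s x) *
          w (x / (2 * Real.pi * s)) := by ring
      _ = _ := by rw [h2, inv_mul_cancel₀ h3]; ring
  have hwi : Integrable w := by
    have h1 := hwc.comp_mul_left' hc.ne'
    simpa [mul_div_cancel_left₀ _ hc.ne'] using h1
  exact integrable_cube hwi (Eventually.of_forall (norm_chirpFourier_le hs v hf hM))

/-- The nonlinearity, pulled back by the free group and chirped, is the inverse Fourier transform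
of the cubic nonlinearity in self-similar coordinates. -/
theorem chirp_mul_freeGroup_neg_cubic {s : ℝ} (hs : 0 < s) {v : L2} {M : ℝ}
    (hv : Integrable v) (hM : ∀ᵐ x, ‖v x‖ ≤ M) (hf : Integrable (freeGroup (-s) v)) :
    (fun x => chirp s x * freeGroup (-s) (cubic v) x) =ᵐ[volume] fun x =>
      ((1 / (2 * Real.pi * s) : ℝ) : ℂ) *
        𝓕⁻ (cube (chirpFourier s (freeGroup (-s) v))) x := by
  have hc : 0 < 2 * Real.pi * s := by have := Real.pi_pos; positivity
  set c := 2 * Real.pi * s with hcdef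
  set w := chirpFourier s (freeGroup (-s) v) with hw
  have h1 : (fun y => chirp (-s) y * cubic v y) =ᵐ[volume] fun y =>
      ((‖kernelConst s‖ ^ 2 : ℝ) : ℂ) * kernelConst s * cube w (y / c) := by
    filter_upwards [cubic_ae_eq hM, ae_eq_chirpFourier hs v hf] with y h1 h2
    rw [h1, cube, h2, ← hw, ← hcdef, cube, norm_mul, norm_mul, norm_chirp, mul_one,
      Complex.real_smul, Complex.real_smul]
    push_cast
    linear_combination ((‖kernelConst s‖ : ℂ) * (‖w (y / c)‖ : ℂ)) ^ 2 * kernelConst s *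
      w (y / c) * chirp_neg_time_mul s y
  filter_upwards [freeGroup_ae_eq (neg_ne_zero.2 hs.ne') (cubic v) (integrable_cubic hv hM)]
    with x hx
  rw [hx, Real.fourier_congr_ae h1]
  have e1 : 𝓕 (fun y => ((‖kernelConst s‖ ^ 2 : ℝ) : ℂ) * kernelConst s * cube w (y / c))
      (x / (2 * Real.pi * -s)) = ((‖kernelConst s‖ ^ 2 : ℝ) : ℂ) * kernelConst s *
        (c * 𝓕⁻ (cube w) x) := by
    have e2 : x / (2 * Real.pi * -s) = -x / c := by rw [hcdef]; field_simp
    have e3 := fourier_comp_div (cube w) hc (-x / c)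
    rw [mul_div_cancel₀ _ hc.ne', ← Real.fourierInv_eq_fourier_neg] at e3
    rw [e2, ← e3, Real.fourier_real_eq_integral_exp_smul, Real.fourier_real_eq_integral_exp_smul,
      ← integral_const_mul]
    refine integral_congr_ae (Eventually.of_forall fun y => ?_)
    simp only [smul_eq_mul]; ring
  rw [e1]
  have e4 : ‖kernelConst s‖ ^ 2 = 1 / c := by
    rw [norm_kernelConst_of_pos hs, div_pow, Real.sq_sqrt hc.le, one_pow]
  have e5 := kernelConst_neg_mul hs
  rw [← hcdef] at e5
  rw [e4]
  have hcc : ((1 / c : ℝ) : ℂ) * (c : ℂ) = 1 := by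
    rw [← Complex.ofReal_mul, one_div_mul_cancel hc.ne', Complex.ofReal_one]
  calc _ = (chirp (-s) x * chirp s x) * (kernelConst (-s) * kernelConst s) *
        (((1 / c : ℝ) : ℂ) * (c : ℂ)) * 𝓕⁻ (cube w) x := by ring
    _ = _ := by rw [chirp_neg_time_mul, e5, hcc]; ring

theorem continuous_cube {w : ℝ → ℂ} (hw : Continuous w) : Continuous (cube w) := by
  unfold cube; fun_prop

/-- Fourier inversion of `chirp_mul_freeGroup_neg_cubic`. In these coordinates the nonlinearity is
local in frequency, with the real coefficient `|w(k)|²/(2πs)` in front of `w(k)`. -/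
theorem chirpFourier_freeGroup_neg_cubic {s : ℝ} (hs : 0 < s) {v : L2} {M : ℝ}
    (hv : Integrable v) (hM : ∀ᵐ x, ‖v x‖ ≤ M) (hf : Integrable (freeGroup (-s) v))
    (hG : Integrable (freeGroup (-s) (cubic v))) (k : ℝ) :
    chirpFourier s (freeGroup (-s) (cubic v)) k =
      ((1 / (2 * Real.pi * s) : ℝ) : ℂ) * cube (chirpFourier s (freeGroup (-s) v)) k := by
  have hc : 0 < 2 * Real.pi * s := by have := Real.pi_pos; positivity
  set w := chirpFourier s (freeGroup (-s) v) with hw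
  have hae := chirp_mul_freeGroup_neg_cubic hs hv hM hf
  have hi : Integrable (𝓕⁻ (cube w)) := by
    have h1 := (integrable_congr hae).1
      (integrable_mul_of_norm_one (continuous_chirp _) (norm_chirp _) hG)
    have h2 := h1.const_mul ((2 * Real.pi * s : ℝ) : ℂ)
    refine h2.congr (Eventually.of_forall fun x => ?_)
    simp only
    rw [← mul_assoc, ← Complex.ofReal_mul, mul_one_div_cancel hc.ne', Complex.ofReal_one, one_mul]
  have hi' : Integrable (𝓕 (cube w)) := by
    have h1 := hi.comp_neg
    rw [fourierInv_eq_comp_neg] at h1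
    simpa only [neg_neg] using h1
  have hinv := (continuous_cube (continuous_chirpFourier s hf)).fourier_fourierInv_eq
    (integrable_cube_chirpFourier hs hv hM hf) hi'
  rw [chirpFourier, Real.fourier_congr_ae hae, ← congrFun hinv k,
    Real.fourier_real_eq_integral_exp_smul, Real.fourier_real_eq_integral_exp_smul,
    ← integral_const_mul]
  refine integral_congr_ae (Eventually.of_forall fun y => ?_)
  simp only [smul_eq_mul]; ring

/-- The profile equation at a fixed frequency is a phase rotation up to decaying errors. -/
theorem exists_cutoffFourier_cubic_sub_le {s : ℝ} (hs : 0 < s) {v : L2} {M : ℝ}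
    (hv : Integrable v) (hM : ∀ᵐ x, ‖v x‖ ≤ M) (hf : normHdot01 (freeGroup (-s) v) ≠ ∞)
    {R : ℝ} (hR : 0 < R) (k : ℝ) :
    ∃ r : ℝ, ‖cutoffFourier R k (freeGroup (-s) (cubic v)) -
        r * cutoffFourier R k (freeGroup (-s) v)‖ ≤
      4 * M ^ 2 * (decayConst s + decayConst (R ^ 2)) * (normHdot01 (freeGroup (-s) v)).toReal := by
  have hc : 0 < 2 * Real.pi * s := by have := Real.pi_pos; positivity
  set f := freeGroup (-s) v with hfdef
  set G := freeGroup (-s) (cubic v) with hGdef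
  set A := (normHdot01 f).toReal with hA
  have hA0 : 0 ≤ A := ENNReal.toReal_nonneg
  have hfA : normHdot01 f = ENNReal.ofReal A := (ENNReal.ofReal_toReal hf).symm
  have hGA : normHdot01 G ≤ ENNReal.ofReal (3 * M ^ 2 * A) := by
    rw [ENNReal.ofReal_mul (by positivity), ← hfA]
    exact normHdot01_freeGroup_neg_cubic_le hs hv hM
  have hfi : Integrable f := integrable_of_normHdot01 hf
  have hGi : Integrable G :=
    integrable_of_normHdot01 (hGA.trans_lt ENNReal.ofReal_lt_top).ne
  have conv : ∀ {z : ℂ} {d B : ℝ} {N : ℝ≥0∞}, 0 ≤ d → 0 ≤ B → N ≤ ENNReal.ofReal B →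
      ‖z‖ₑ ≤ ENNReal.ofReal d * N → ‖z‖ ≤ d * B := by
    intro z d B N hd hB hN h
    have h1 := h.trans (mul_le_mul_right hN _)
    rw [← ENNReal.ofReal_mul hd, ← ofReal_norm] at h1
    exact (ENNReal.ofReal_le_ofReal_iff (by positivity)).1 h1
  set w := chirpFourier s f with hw
  -- The coefficient of the exact identity for the chirped transform; it is at most `M²` by
  -- `norm_chirpFourier_le`.
  refine ⟨1 / (2 * Real.pi * s) * ‖w k‖ ^ 2, ?_⟩
  have hr0 : 0 ≤ 1 / (2 * Real.pi * s) * ‖w k‖ ^ 2 := by positivity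
  have hr : 1 / (2 * Real.pi * s) * ‖w k‖ ^ 2 ≤ M ^ 2 := by
    have h1 : ‖w k‖ ≤ Real.sqrt (2 * Real.pi * s) * M := norm_chirpFourier_le hs v hfi hM k
    have h2 : ‖w k‖ ^ 2 ≤ (Real.sqrt (2 * Real.pi * s) * M) ^ 2 := by gcongr
    rw [mul_pow, Real.sq_sqrt hc.le] at h2
    rw [one_div_mul_eq_div, div_le_iff₀ hc]
    linarith
  set r := 1 / (2 * Real.pi * s) * ‖w k‖ ^ 2 with hrdef
  have hWG : chirpFourier s G k = r * w k := by
    rw [hGdef, chirpFourier_freeGroup_neg_cubic hs hv hM hfi hGi, cube, ← hfdef, ← hw,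
      Complex.real_smul, hrdef]
    push_cast; ring
  have d0 := decayConst_nonneg s
  have d1 := decayConst_nonneg (R ^ 2)
  have b1 : ‖cutoffFourier R k G - 𝓕 (G : ℝ → ℂ) k‖ ≤ decayConst (R ^ 2) * (3 * M ^ 2 * A) :=
    conv d1 (by positivity) hGA (enorm_cutoffFourier_sub_le hR hGi k)
  have b2 : ‖chirpFourier s G k - 𝓕 (G : ℝ → ℂ) k‖ ≤ decayConst s * (3 * M ^ 2 * A) :=
    conv d0 (by positivity) hGA (enorm_fourier_chirp_sub_le hs hGi k)
  have b3 : ‖w k - 𝓕 (f : ℝ → ℂ) k‖ ≤ decayConst s * A :=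
    conv d0 hA0 hfA.le (enorm_fourier_chirp_sub_le hs hfi k)
  have b4 : ‖cutoffFourier R k f - 𝓕 (f : ℝ → ℂ) k‖ ≤ decayConst (R ^ 2) * A :=
    conv d1 hA0 hfA.le (enorm_cutoffFourier_sub_le hR hfi k)
  -- The cutoff and the chirp are each compared with the plain Fourier integral. The two errors for
  -- `G` carry `3M²` and the two for `f` carry `r ≤ M²`, whence the factor `4`.
  have e : cutoffFourier R k G - r * cutoffFourier R k f =
      (cutoffFourier R k G - 𝓕 (G : ℝ → ℂ) k) - (chirpFourier s G k - 𝓕 (G : ℝ → ℂ) k) +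
      (r * (w k - 𝓕 (f : ℝ → ℂ) k) - r * (cutoffFourier R k f - 𝓕 (f : ℝ → ℂ) k)) := by
    rw [hWG]; ring
  have b5 : ‖(r : ℂ) * (w k - 𝓕 (f : ℝ → ℂ) k)‖ ≤ M ^ 2 * (decayConst s * A) := by
    rw [norm_mul, Complex.norm_real, Real.norm_of_nonneg hr0]; gcongr
  have b6 : ‖(r : ℂ) * (cutoffFourier R k f - 𝓕 (f : ℝ → ℂ) k)‖ ≤
      M ^ 2 * (decayConst (R ^ 2) * A) := by
    rw [norm_mul, Complex.norm_real, Real.norm_of_nonneg hr0]; gcongr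
  rw [e]
  refine (norm_add_le _ _).trans ((add_le_add (norm_sub_le _ _) (norm_sub_le _ _)).trans ?_)
  linarith

/-! ### Modulus bounds for a perturbed phase rotation. -/

theorem hasDerivAt_integral_of_continuousOn {E : Type*} [NormedAddCommGroup E] [NormedSpace ℝ E]
    [CompleteSpace E] {b : ℝ → E} {t₀ t₁ s : ℝ} (hb : ContinuousOn b (Icc t₀ t₁))
    (hs : s ∈ Ioo t₀ t₁) : HasDerivAt (fun τ => ∫ σ in t₀..τ, b σ) (b s) s := by
  refine intervalIntegral.integral_hasDerivAt_right ?_ ?_ ?_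
  · refine (hb.mono ?_).intervalIntegrable
    rw [uIcc_of_le hs.1.le]
    exact Icc_subset_Icc_right hs.2.le
  · exact (hb.mono Ioo_subset_Icc_self).stronglyMeasurableAtFilter isOpen_Ioo s hs
  · exact hb.continuousAt (Icc_mem_nhds hs.1 hs.2)

theorem continuousOn_integral_of_continuousOn {E : Type*} [NormedAddCommGroup E] [NormedSpace ℝ E]
    {b : ℝ → E} {t₀ t₁ : ℝ} (h : t₀ ≤ t₁) (hb : ContinuousOn b (Icc t₀ t₁)) :
    ContinuousOn (fun τ => ∫ σ in t₀..τ, b σ) (Icc t₀ t₁) := by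
  have := intervalIntegral.continuousOn_primitive_interval (μ := volume) (f := b) (a := t₀)
    (b := t₁) (by rw [uIcc_of_le h]; exact hb.integrableOn_Icc)
  rwa [uIcc_of_le h] at this

/-- A Duhamel identity with an integrand of the form `rotation + error` bounds the growth of the
modulus by the integral of the error. -/
theorem norm_le_of_rotation {a b : ℝ → ℂ} {t : ℝ} (ht : 1 ≤ t) (hb : ContinuousOn b (Icc 1 t))
    (ha : ∀ τ ∈ Icc 1 t, a τ = a 1 - Complex.I * ∫ s in (1 : ℝ)..τ, b s) {E : ℝ → ℝ}
    (hE : IntervalIntegrable E volume 1 t)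
    (h : ∀ᵐ s ∂volume.restrict (Icc 1 t), ∃ r : ℝ, ‖b s - r * a s‖ ≤ E s) :
    ‖a t‖ ≤ ‖a 1‖ + ∫ s in (1 : ℝ)..t, E s := by
  have hac : ContinuousOn a (Icc 1 t) :=
    (continuousOn_const.sub (continuousOn_const.mul
      (continuousOn_integral_of_continuousOn ht hb))).congr ha
  have had : ∀ s ∈ Ioo 1 t, HasDerivAt a (-(Complex.I * b s)) s := by
    intro s hs
    have h1 := ((hasDerivAt_integral_of_continuousOn hb hs).const_mul Complex.I).const_sub (a 1)
    refine h1.congr_of_eventuallyEq ?_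
    filter_upwards [Icc_mem_nhds hs.1 hs.2] with τ hτ using ha τ hτ
  have key : ∀ δ : ℝ, 0 < δ → ‖a t‖ ≤ ‖a 1‖ + δ + ∫ s in (1 : ℝ)..t, E s := by
    intro δ hδ
    -- The modulus is regularised by `δ` since it need not be differentiable at zeros of `a`.
    set φ : ℝ → ℝ := fun s => Real.sqrt (‖a s‖ ^ 2 + δ ^ 2) with hφ
    have hpos : ∀ s, 0 < ‖a s‖ ^ 2 + δ ^ 2 := fun s => by positivity
    have hφpos : ∀ s, 0 < φ s := fun s => Real.sqrt_pos.2 (hpos s)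
    have hφc : ContinuousOn φ (Icc 1 t) := ((hac.norm.pow 2).add continuousOn_const).sqrt
    set φ' : ℝ → ℝ := fun s => 2 * inner ℝ (a s) (-(Complex.I * b s)) / (2 * φ s) with hφ'
    have hφd : ∀ s ∈ Ioo 1 t, HasDerivAt φ (φ' s) s := by
      intro s hs
      exact ((had s hs).norm_sq.add_const (δ ^ 2)).sqrt (hpos s).ne'
    have hφ'c : ContinuousOn φ' (Icc 1 t) := by
      refine ContinuousOn.div ?_ (continuousOn_const.mul hφc) fun s _ => by
        have := hφpos s; positivity
      exact continuousOn_const.mul (hac.inner (continuousOn_const.mul hb).neg)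
    have hint : IntervalIntegrable φ' volume 1 t := by
      refine ContinuousOn.intervalIntegrable ?_
      rwa [uIcc_of_le ht]
    have hftc := intervalIntegral.integral_eq_sub_of_hasDerivAt_of_le ht hφc hφd hint
    have hmono : ∫ s in (1 : ℝ)..t, φ' s ≤ ∫ s in (1 : ℝ)..t, E s := by
      refine intervalIntegral.integral_mono_ae_restrict ht hint hE ?_
      filter_upwards [h] with s hs
      obtain ⟨r, hr⟩ := hs
      -- For real `r` the vector `-i r a` is orthogonal to `a`, so the rotation does not affect the
      -- modulus.
      have e1 : inner ℝ (a s) (-(Complex.I * b s)) =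
          inner ℝ (a s) (-(Complex.I * (b s - r * a s))) := by
        simp only [Complex.inner, Complex.mul_re, Complex.neg_re, Complex.neg_im, Complex.conj_re,
          Complex.conj_im, Complex.I_re, Complex.I_im, Complex.mul_im, Complex.sub_re,
          Complex.sub_im, Complex.ofReal_re, Complex.ofReal_im]
        ring
      have e2 : inner ℝ (a s) (-(Complex.I * (b s - r * a s))) ≤ φ s * E s := by
        refine (real_inner_le_norm _ _).trans ?_
        rw [norm_neg, norm_mul, Complex.norm_I, one_mul]
        refine mul_le_mul ?_ hr (norm_nonneg _) (hφpos s).le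
        exact Real.le_sqrt_of_sq_le (by nlinarith [sq_nonneg δ])
      simp only [hφ', e1]
      rw [mul_div_mul_left _ _ two_ne_zero, div_le_iff₀ (hφpos s), mul_comm (E s)]
      exact e2
    have h1 : ‖a t‖ ≤ φ t := Real.le_sqrt_of_sq_le (by nlinarith [sq_nonneg δ])
    have h2 : φ 1 ≤ ‖a 1‖ + δ := by
      rw [hφ, Real.sqrt_le_left (by positivity)]
      nlinarith [norm_nonneg (a 1)]
    linarith
  refine le_of_forall_pos_le_add fun δ hδ => ?_
  linarith [key δ hδ]

/-! ### Qualitative bounds along a continuous trajectory. -/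

theorem normHdot10_add_le (f g : L2) : normHdot10 (f + g) ≤ normHdot10 f + normHdot10 g := by
  have h := normHdot10_sub_le f ((-1 : ℂ) • g)
  rwa [normHdot10_smul, neg_one_smul, sub_neg_eq_add, enorm_neg, enorm_one, one_mul] at h

theorem normHdot01_add_le (f g : L2) : normHdot01 (f + g) ≤ normHdot01 f + normHdot01 g := by
  have h := normHdot01_sub_le f ((-1 : ℂ) • g)
  rwa [normHdot01_smul, neg_one_smul, sub_neg_eq_add, enorm_neg, enorm_one, one_mul] at h

/-- Near each `t₀` the trajectory stays within distance `1` of `u t₀`; compactness of the interval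
makes the bound uniform. -/
theorem exists_bound_of_continuousIntoH {T : ℝ} {u : ℝ → L2} (hu : ContinuousIntoH T u) :
    ∃ K : ℝ≥0, ∀ t ∈ Icc 1 T, normHdot10 (u t) ≤ K ∧ normHdot01 (u t) ≤ K ∧ ‖u t‖ₑ ≤ K := by
  refine isCompact_Icc.induction_on (p := fun S => ∃ K : ℝ≥0, ∀ t ∈ S,
    normHdot10 (u t) ≤ K ∧ normHdot01 (u t) ≤ K ∧ ‖u t‖ₑ ≤ K) ⟨0, by simp⟩ ?_ ?_ ?_
  · rintro S S' hS ⟨K, hK⟩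
    exact ⟨K, fun t ht => hK t (hS ht)⟩
  · rintro S S' ⟨K, hK⟩ ⟨K', hK'⟩
    refine ⟨max K K', fun t ht => ?_⟩
    rcases ht with ht | ht
    · have h1 : (K : ℝ≥0∞) ≤ (max K K' : ℝ≥0) := by exact_mod_cast le_max_left K K'
      obtain ⟨a, b, c⟩ := hK t ht
      exact ⟨a.trans h1, b.trans h1, c.trans h1⟩
    · have h1 : (K' : ℝ≥0∞) ≤ (max K K' : ℝ≥0) := by exact_mod_cast le_max_right K K'
      obtain ⟨a, b, c⟩ := hK' t ht
      exact ⟨a.trans h1, b.trans h1, c.trans h1⟩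
  · intro t₀ ht₀
    obtain ⟨h10, h01⟩ := hu.1 t₀ ht₀
    have hev := (hu.2 t₀ ht₀).eventually (gt_mem_nhds (zero_lt_one (α := ℝ≥0∞)))
    refine ⟨_, hev, (1 + normH10 (u t₀) + normH01 (u t₀)).toNNReal, fun t ht => ?_⟩
    rw [ENNReal.coe_toNNReal (by simp [h10.ne, h01.ne])]
    have ht' : normH10 (u t - u t₀) + normH01 (u t - u t₀) < 1 := ht
    have d10 : normH10 (u t - u t₀) ≤ 1 := le_self_add.trans ht'.le
    have d01 : normH01 (u t - u t₀) ≤ 1 := le_add_self.trans ht'.le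
    refine ⟨?_, ?_, ?_⟩
    · have h := normHdot10_add_le (u t - u t₀) (u t₀)
      rw [sub_add_cancel] at h
      exact h.trans ((add_le_add ((normHdot10_le_normH10 _).trans d10)
        (normHdot10_le_normH10 _)).trans le_self_add)
    · have h := normHdot01_add_le (u t - u t₀) (u t₀)
      rw [sub_add_cancel] at h
      refine h.trans ((add_le_add ((normHdot01_le_normH01 _).trans d01)
        (normHdot01_le_normH01 _)).trans ?_)
      rw [add_right_comm]
      exact le_self_add
    · have h := enorm_add_le (u t - u t₀) (u t₀)
      rw [sub_add_cancel] at h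
      have e : ∀ g : L2, ‖g‖ₑ ≤ normH01 g := fun g =>
        (eLpNorm_coeFn g).symm.le.trans (eLpNorm_le_normH01 g)
      refine h.trans ((add_le_add ((e _).trans d01) (e _)).trans ?_)
      rw [add_right_comm]
      exact le_self_add

theorem continuousOn_of_continuousIntoH {T : ℝ} {u : ℝ → L2} (hu : ContinuousIntoH T u) :
    ContinuousOn u (Icc 1 T) := by
  intro t₀ ht₀
  rw [ContinuousWithinAt, Lp.tendsto_Lp_iff_tendsto_eLpNorm']
  refine tendsto_of_tendsto_of_tendsto_of_le_of_le tendsto_const_nhds (hu.2 t₀ ht₀)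
    (fun _ => zero_le) fun t => ?_
  simp only
  rw [← eLpNorm_congr_ae (Lp.coeFn_sub (u t) (u t₀))]
  exact (eLpNorm_le_normH01 _).trans le_add_self

theorem norm_profile (u : ℝ → L2) (t : ℝ) : ‖profile u t‖ = ‖u t‖ := norm_freeGroup _ _

theorem normHdot10_profile (u : ℝ → L2) (t : ℝ) : normHdot10 (profile u t) = normHdot10 (u t) :=
  normHdot10_freeGroup _ _

/-- Uniform bounds on a continuous trajectory, including its profile and its sup norm. -/
theorem exists_uniform_bounds {T : ℝ} {u : ℝ → L2} (hu : ContinuousIntoH T u) :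
    ∃ K : ℝ≥0, ∀ t ∈ Icc 1 T, normHdot10 (u t) ≤ K ∧ normHdot01 (u t) ≤ K ∧ ‖u t‖ₑ ≤ K ∧
      normHdot01 (profile u t) ≤ K ∧ ∀ᵐ x, ‖u t x‖ ≤ K := by
  obtain ⟨K, hK⟩ := exists_bound_of_continuousIntoH hu
  set L : ℝ≥0∞ := ENNReal.ofReal T * K + K with hL
  have hLtop : L ≠ ∞ := by simp [hL, ENNReal.mul_eq_top]
  -- `L` bounds the weighted norm of the profile and `B` its `L¹` norm, hence also its chirped
  -- Fourier transform.
  set B : ℝ≥0∞ := ENNReal.ofReal (Real.sqrt Real.pi) * (K + L) with hB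
  have hBtop : B ≠ ∞ := ENNReal.mul_ne_top ENNReal.ofReal_ne_top (by simp [hLtop])
  refine ⟨K + L.toNNReal + B.toNNReal, fun t ht => ?_⟩
  obtain ⟨h1, h2, h3⟩ := hK t ht
  have ht0 : 0 < t := zero_lt_one.trans_le ht.1
  have hint : Integrable (u t) := integrable_of_normHdot01 (h2.trans_lt ENNReal.coe_lt_top).ne
  have hprof : normHdot01 (profile u t) ≤ L := by
    refine (normHdot01_freeGroup_neg_le ht0 (u t) hint).trans ?_
    exact add_le_add (mul_le_mul' (ENNReal.ofReal_le_ofReal ht.2) h1) h2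
  have hfint : Integrable (profile u t) :=
    integrable_of_normHdot01 (hprof.trans_lt hLtop.lt_top).ne
  have hK1 : (K : ℝ≥0∞) ≤ (K + L.toNNReal + B.toNNReal : ℝ≥0) := by
    push_cast; rw [add_assoc]; exact le_self_add
  have hK2 : L ≤ (K + L.toNNReal + B.toNNReal : ℝ≥0) := by
    push_cast; rw [ENNReal.coe_toNNReal hLtop, add_right_comm]; exact le_add_self
  refine ⟨h1.trans hK1, h2.trans hK1, h3.trans hK1, hprof.trans hK2, ?_⟩
  have hw : ∀ k, ‖chirpFourier t (profile u t) k‖ ≤ B.toReal := by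
    intro k
    refine (norm_fourier_le k).trans ?_
    simp only [norm_mul, norm_chirp, one_mul]
    rw [integral_norm_eq_lintegral_enorm hfint.1, ← eLpNorm_one_eq_lintegral_enorm]
    refine ENNReal.toReal_mono hBtop ((eLpNorm_one_le_normH01 _).trans ?_)
    refine mul_le_mul_right ((normH01_le _).trans (add_le_add ?_ hprof)) _
    rwa [← ofReal_norm, norm_profile, ofReal_norm]
  filter_upwards [ae_norm_le_of_chirpFourier ht0 (u t) hfint hw] with x hx
  refine hx.trans ?_
  have hc : 1 ≤ Real.sqrt (2 * Real.pi * t) := by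
    rw [Real.one_le_sqrt]; nlinarith [Real.pi_gt_three, ht.1]
  have : 1 / Real.sqrt (2 * Real.pi * t) * B.toReal ≤ 1 * B.toReal := by
    gcongr
    exact (div_le_one (by linarith)).2 hc
  push_cast
  linarith [NNReal.coe_nonneg K, ENNReal.toReal_nonneg (a := L)]

/-! ### Duhamel's formula for the profile and conservation of mass. -/

/-- The nonlinearity pulled back by the free group. -/
def pulledCubic (u : ℝ → L2) (s : ℝ) : L2 := freeGroup (-s) (cubic (u s))

theorem continuousOn_cubic {T : ℝ} {u : ℝ → L2} (hu : ContinuousIntoH T u) :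
    ContinuousOn (fun s => cubic (u s)) (Icc 1 T) := by
  obtain ⟨K, hK⟩ := exists_uniform_bounds hu
  intro s₀ hs₀
  have h1 : Tendsto (fun s => 3 * (K : ℝ) ^ 2 * ‖u s - u s₀‖) (𝓝[Icc 1 T] s₀) (𝓝 0) := by
    have := (tendsto_iff_norm_sub_tendsto_zero.1
      (continuousOn_of_continuousIntoH hu s₀ hs₀)).const_mul (3 * (K : ℝ) ^ 2)
    simpa using this
  refine tendsto_iff_norm_sub_tendsto_zero.2 (squeeze_zero' (Eventually.of_forall fun s =>
    norm_nonneg _) ?_ h1)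
  filter_upwards [self_mem_nhdsWithin] with s hs
  exact norm_cubic_sub_cubic_le (hK s hs).2.2.2.2 (hK s₀ hs₀).2.2.2.2

theorem continuousOn_pulledCubic {T : ℝ} {u : ℝ → L2} (hu : ContinuousIntoH T u) :
    ContinuousOn (pulledCubic u) (Icc 1 T) :=
  continuousOn_freeGroup_comp continuousOn_neg (continuousOn_cubic hu)

theorem intervalIntegrable_of_continuousOn_Icc {E : Type*} [NormedAddCommGroup E] {G : ℝ → E}
    {T t : ℝ} (hG : ContinuousOn G (Icc 1 T)) (ht : t ∈ Icc 1 T) :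
    IntervalIntegrable G volume 1 t := by
  refine (hG.mono ?_).intervalIntegrable
  rw [uIcc_of_le ht.1]
  exact Icc_subset_Icc_right ht.2

/-- Duhamel's formula for the profile. -/
theorem profile_eq {T : ℝ} {uStar : L2} {u : ℝ → L2} (hu : IsSolution T uStar u) {t : ℝ}
    (ht : t ∈ Icc 1 T) :
    profile u t = uStar - Complex.I • ∫ s in (1 : ℝ)..t, pulledCubic u s := by
  have hint : IntervalIntegrable (fun s => freeGroup (t - s) (cubic (u s))) volume 1 t :=
    intervalIntegrable_of_continuousOn_Icc (continuousOn_freeGroup_comp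
      (continuousOn_const.sub continuousOn_id) (continuousOn_cubic hu.continuous)) ht
  have h := (freeGroupIsometry (-t)).toContinuousLinearMap.intervalIntegral_comp_comm hint
  simp only [LinearIsometry.coe_toContinuousLinearMap, freeGroupIsometry_apply,
    freeGroup_freeGroup, neg_add_eq_sub, sub_sub_cancel_left] at h
  have h2 : profile u t = freeGroupIsometry (-t) (u t) := rfl
  rw [h2, hu.duhamel t ht, map_sub, map_smul, freeGroupIsometry_apply, freeGroup_freeGroup,
    neg_add_cancel, freeGroup_zero, freeGroupIsometry_apply, ← h]
  rfl

/-- Conservation of the `L²` norm. -/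
theorem norm_eq_of_isSolution {T : ℝ} {uStar : L2} {u : ℝ → L2} (hu : IsSolution T uStar u) {t : ℝ}
    (ht : t ∈ Icc 1 T) : ‖u t‖ = ‖uStar‖ := by
  obtain ⟨K, hK⟩ := exists_uniform_bounds hu.continuous
  have hT : (1 : ℝ) ≤ T := ht.1.trans ht.2
  have hG := continuousOn_pulledCubic hu.continuous
  -- The Duhamel expression agrees with the profile on `[1, T]` and is visibly differentiable in the
  -- interior.
  set F : ℝ → L2 := fun τ => uStar - Complex.I • ∫ s in (1 : ℝ)..τ, pulledCubic u s with hF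
  have hIc : ContinuousOn (fun τ => ∫ s in (1 : ℝ)..τ, pulledCubic u s) (Icc 1 T) :=
    continuousOn_integral_of_continuousOn hT hG
  have hIc' : ContinuousOn (fun τ => Complex.I • ∫ s in (1 : ℝ)..τ, pulledCubic u s) (Icc 1 T) :=
    (continuous_const_smul Complex.I).comp_continuousOn hIc
  have hF0 : ContinuousOn F (Icc 1 T) := continuousOn_const.sub hIc'
  have hFc : ContinuousOn (fun τ => ‖F τ‖ ^ 2) (Icc 1 t) :=
    (hF0.norm.pow 2).mono (Icc_subset_Icc_right ht.2)
  have hFd : ∀ s ∈ Ioo 1 t, HasDerivAt (fun τ => ‖F τ‖ ^ 2) 0 s := by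
    intro s hs
    have hsT : s ∈ Icc 1 T := ⟨hs.1.le, hs.2.le.trans ht.2⟩
    have h0 : HasDerivAt (fun τ => ∫ s in (1 : ℝ)..τ, pulledCubic u s) (pulledCubic u s) s :=
      hasDerivAt_integral_of_continuousOn hG ⟨hs.1, hs.2.trans_le ht.2⟩
    have h1 : HasDerivAt (fun τ => Complex.I • ∫ s in (1 : ℝ)..τ, pulledCubic u s)
        (Complex.I • pulledCubic u s) s := h0.const_smul Complex.I
    have h2 : HasDerivAt F (-(Complex.I • pulledCubic u s)) s := h1.const_sub uStar
    have h3 := HasDerivAt.inner ℂ h2 h2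
    -- The isometry removes the free group from the pairing, leaving the real quantity of
    -- `inner_cubic_im`.
    have h4 : inner ℂ (F s) (pulledCubic u s) = inner ℂ (u s) (cubic (u s)) := by
      rw [show F s = profile u s from (profile_eq hu hsT).symm]
      exact (freeGroupIsometry (-s)).inner_map_map _ _
    have h5 : inner ℂ (pulledCubic u s) (F s) = inner ℂ (cubic (u s)) (u s) := by
      rw [← inner_conj_symm, h4, inner_conj_symm]
    have him : (inner ℂ (u s) (cubic (u s))).im = 0 := inner_cubic_im (hK s hsT).2.2.2.2
    have him' : (inner ℂ (cubic (u s)) (u s)).im = 0 := by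
      rw [← inner_conj_symm, Complex.conj_im, him, neg_zero]
    have h6 := (Complex.reCLM.hasFDerivAt.comp_hasDerivAt s h3)
    have e : (fun τ => ‖F τ‖ ^ 2) = Complex.reCLM ∘ fun τ => inner ℂ (F τ) (F τ) := by
      ext τ
      simp only [Function.comp, Complex.reCLM_apply]
      exact (inner_self_eq_norm_sq (𝕜 := ℂ) (F τ)).symm
    have h7 : Complex.reCLM (inner ℂ (F s) (-(Complex.I • pulledCubic u s)) +
        inner ℂ (-(Complex.I • pulledCubic u s)) (F s)) = 0 := by
      rw [inner_neg_right, inner_neg_left, inner_smul_right, inner_smul_left, h4, h5]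
      simp [him, him']
    rw [h7] at h6
    rw [e]
    exact h6
  have h := intervalIntegral.integral_eq_sub_of_hasDerivAt_of_le ht.1 hFc hFd (by simp)
  have h1 : F t = profile u t := (profile_eq hu ht).symm
  have h2 : F 1 = uStar := by simp [hF]
  simp only [intervalIntegral.integral_zero, h1, h2, norm_profile] at h
  have h3 : ‖u t‖ ^ 2 = ‖uStar‖ ^ 2 := by linarith
  exact (pow_left_inj₀ (norm_nonneg _) (norm_nonneg _) two_ne_zero).1 h3

/-! ### The `X_T` norm pointwise in time, and the growth bounds. -/

theorem supTime_le {T : ℝ} {φ : ℝ → ℝ≥0∞} {B : ℝ≥0∞} (h : ∀ t ∈ Icc 1 T, φ t ≤ B) :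
    supTime T φ ≤ B :=
  essSup_le_of_ae_le B (ae_restrict_of_forall_mem measurableSet_Icc h)

theorem le_ofReal_of_rpow_mul_le {s β y : ℝ} (hs : 0 < s) {N : ℝ≥0∞} (hy : 0 ≤ y)
    (h : ENNReal.ofReal (s ^ β) * N ≤ ENNReal.ofReal y) : N ≤ ENNReal.ofReal (y * s ^ (-β)) := by
  have e : ENNReal.ofReal (s ^ (-β)) * ENNReal.ofReal (s ^ β) = 1 := by
    rw [← ENNReal.ofReal_mul (by positivity), ← Real.rpow_add hs, neg_add_cancel, Real.rpow_zero,
      ENNReal.ofReal_one]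
  calc N = ENNReal.ofReal (s ^ (-β)) * (ENNReal.ofReal (s ^ β) * N) := by
        rw [← mul_assoc, e, one_mul]
    _ ≤ ENNReal.ofReal (s ^ (-β)) * ENNReal.ofReal y := mul_le_mul_right h _
    _ = _ := by rw [mul_comm, ENNReal.ofReal_mul hy]

theorem rpow_mul_le_of_le_ofReal {s β y : ℝ} (hs : 0 < s) {N : ℝ≥0∞}
    (h : N ≤ ENNReal.ofReal (y * s ^ β)) : ENNReal.ofReal (s ^ (-β)) * N ≤ ENNReal.ofReal y := by
  refine (mul_le_mul_right h _).trans (le_of_eq ?_)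
  rw [← ENNReal.ofReal_mul (by positivity), mul_left_comm, ← Real.rpow_add hs, neg_add_cancel,
    Real.rpow_zero, mul_one]

theorem ae_norm_le_of_eLpNorm_top_le {g : ℝ → ℂ} {M : ℝ} (hM : 0 ≤ M)
    (h : eLpNorm g ∞ volume ≤ ENNReal.ofReal M) : ∀ᵐ x, ‖g x‖ ≤ M := by
  rw [eLpNorm_exponent_top] at h
  filter_upwards [ae_le_eLpNormEssSup (f := g) (μ := volume)] with x hx
  have h1 := hx.trans h
  rw [← ofReal_norm] at h1
  exact (ENNReal.ofReal_le_ofReal_iff hM).1 h1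

theorem eLpNorm_top_le_of_ae_norm_le {g : ℝ → ℂ} {M : ℝ} (h : ∀ᵐ x, ‖g x‖ ≤ M) :
    eLpNorm g ∞ volume ≤ ENNReal.ofReal M := by
  rw [eLpNorm_exponent_top]
  exact eLpNormEssSup_le_of_ae_bound h

/-- The bound depends on `u` and `T`. It is needed only so that the norm can be treated as a real
number `x`. -/
theorem normX_lt_top {α T : ℝ} (hα : 0 < α) {u : ℝ → L2} (hu : ContinuousIntoH T u) :
    normX α T u < ∞ := by
  obtain ⟨K, hK⟩ := exists_uniform_bounds hu
  have hle : ∀ t ∈ Icc 1 T, ENNReal.ofReal (t ^ (-α)) ≤ 1 := fun t ht => by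
    rw [ENNReal.ofReal_le_one]
    exact Real.rpow_le_one_of_one_le_of_nonpos ht.1 (by linarith)
  have h1 : supTime T (fun t => ENNReal.ofReal (t ^ (1 / 2 : ℝ)) * eLpNorm (u t) ∞ volume) ≤
      ENNReal.ofReal (T ^ (1 / 2 : ℝ)) * K := by
    refine supTime_le fun t ht => ?_
    have ht0 : 0 ≤ t := zero_le_one.trans ht.1
    refine mul_le_mul' (ENNReal.ofReal_le_ofReal
      (Real.rpow_le_rpow ht0 ht.2 (by norm_num))) ?_
    have := eLpNorm_top_le_of_ae_norm_le (hK t ht).2.2.2.2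
    rwa [ENNReal.ofReal_coe_nnreal] at this
  have h2 : supTime T (fun t => ENNReal.ofReal (t ^ (-α)) * normHdot10 (u t)) ≤ K :=
    supTime_le fun t ht => (mul_le_mul' (hle t ht) (hK t ht).1).trans (one_mul _).le
  have h3 : supTime T (fun t => ENNReal.ofReal (t ^ (-α)) * normHdot01 (profile u t)) ≤ K :=
    supTime_le fun t ht => (mul_le_mul' (hle t ht) (hK t ht).2.2.2.1).trans (one_mul _).le
  have h4 : supTime T (fun t => eLpNorm (u t) 2 volume) ≤ K :=
    supTime_le fun t ht => (eLpNorm_coeFn _).le.trans (hK t ht).2.2.1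
  unfold normX
  refine (add_le_add (add_le_add (add_le_add h1 h2) h3) h4).trans_lt ?_
  simp [ENNReal.mul_lt_top]

theorem ae_le_of_supTime_le {T y : ℝ} {φ : ℝ → ℝ≥0∞}
    (h : supTime T φ ≤ ENNReal.ofReal y) :
    ∀ᵐ s ∂volume.restrict (Icc 1 T), φ s ≤ ENNReal.ofReal y := by
  filter_upwards [ENNReal.ae_le_essSup φ] with s hs using hs.trans h

/-- The pointwise in time content of a bound on the `X_T` norm. -/
theorem ae_bounds_of_normX_le {α T x : ℝ} (hx : 0 ≤ x) {u : ℝ → L2}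
    (h : normX α T u ≤ ENNReal.ofReal x) :
    ∀ᵐ s ∂volume.restrict (Icc 1 T), (∀ᵐ y, ‖u s y‖ ≤ x * s ^ (-(1 / 2) : ℝ)) ∧
      normHdot10 (u s) ≤ ENNReal.ofReal (x * s ^ α) ∧
      normHdot01 (profile u s) ≤ ENNReal.ofReal (x * s ^ α) := by
  unfold normX at h
  have h123 := le_self_add.trans h
  have h12 := le_self_add.trans h123
  filter_upwards [ae_le_of_supTime_le (le_self_add.trans h12),
    ae_le_of_supTime_le (le_add_self.trans h12), ae_le_of_supTime_le (le_add_self.trans h123),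
    ae_restrict_mem measurableSet_Icc] with s h1 h2 h3 hs
  have hs0 : 0 < s := zero_lt_one.trans_le hs.1
  refine ⟨ae_norm_le_of_eLpNorm_top_le (by positivity) (le_ofReal_of_rpow_mul_le hs0 hx h1), ?_, ?_⟩
  · simpa using le_ofReal_of_rpow_mul_le hs0 hx h2
  · simpa using le_ofReal_of_rpow_mul_le hs0 hx h3

/-- The contribution of the endpoint `1` is negative and dropped. Positivity of `α` turns a
logarithm into `t^α/α`, which is where `C` acquires its dependence on `α`. -/
theorem lintegral_rpow_le {α c t : ℝ} (hα : 0 < α) (hc : 0 ≤ c) (ht : 1 ≤ t) :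
    ∫⁻ s in Icc 1 t, ENNReal.ofReal (c * s ^ (α - 1)) ≤ ENNReal.ofReal (c / α * t ^ α) := by
  have hcont : ContinuousOn (fun s : ℝ => c * s ^ (α - 1)) (Icc 1 t) := by
    refine continuousOn_const.mul (continuousOn_id.rpow_const fun s hs => Or.inl ?_)
    exact (zero_lt_one.trans_le hs.1).ne'
  rw [← ofReal_integral_eq_lintegral_ofReal hcont.integrableOn_Icc
    (ae_restrict_of_forall_mem measurableSet_Icc fun s hs => by
      have : 0 ≤ s := zero_le_one.trans hs.1
      simp only [Pi.zero_apply]; positivity)]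
  refine ENNReal.ofReal_le_ofReal ?_
  rw [integral_Icc_eq_integral_Ioc, ← intervalIntegral.integral_of_le ht,
    intervalIntegral.integral_const_mul, integral_rpow (Or.inl (by linarith)), sub_add_cancel,
    Real.one_rpow, mul_div_assoc', div_mul_eq_mul_div]
  gcongr
  linarith

/-- The growth bounds for the energy and the weighted norm. -/
theorem growth_bounds {α T x : ℝ} (hα : 0 < α) (hx : 0 ≤ x) {uStar : L2} {u : ℝ → L2}
    (hu : IsSolution T uStar u) (hX : normX α T u ≤ ENNReal.ofReal x) {t : ℝ}
    (ht : t ∈ Icc 1 T) :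
    normHdot10 (u t) ≤ normHdot10 uStar + ENNReal.ofReal (3 * x ^ 3 / α * t ^ α) ∧
    normHdot01 (profile u t) ≤ normHdot01 uStar + ENNReal.ofReal (3 * x ^ 3 / α * t ^ α) := by
  obtain ⟨K, hK⟩ := exists_uniform_bounds hu.continuous
  have hG := intervalIntegrable_of_continuousOn_Icc (continuousOn_pulledCubic hu.continuous) ht
  have hae : ∀ᵐ s ∂volume.restrict (Icc 1 t),
      normHdot10 (pulledCubic u s) ≤ ENNReal.ofReal (3 * x ^ 3 * s ^ (α - 1)) ∧
      normHdot01 (pulledCubic u s) ≤ ENNReal.ofReal (3 * x ^ 3 * s ^ (α - 1)) := by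
    have hmono : volume.restrict (Icc 1 t) ≤ volume.restrict (Icc 1 T) :=
      Measure.restrict_mono (Icc_subset_Icc_right ht.2) le_rfl
    filter_upwards [ae_mono hmono (ae_bounds_of_normX_le hx hX),
      ae_restrict_mem measurableSet_Icc] with s hs hst
    obtain ⟨h1, h2, h3⟩ := hs
    have hs0 : 0 < s := zero_lt_one.trans_le hst.1
    have hint : Integrable (u s) := integrable_of_normHdot01
      ((hK s ⟨hst.1, hst.2.trans ht.2⟩).2.1.trans_lt ENNReal.coe_lt_top).ne
    -- Two factors of the sup norm, each `x s^{-1/2}`, and one growing norm `x s^α`.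
    have e : 3 * x ^ 3 * s ^ (α - 1) = 3 * (x * s ^ (-(1 / 2) : ℝ)) ^ 2 * (x * s ^ α) := by
      rw [mul_pow, ← Real.rpow_natCast (s ^ (-(1 / 2) : ℝ)) 2, ← Real.rpow_mul hs0.le,
        sub_eq_add_neg, Real.rpow_add hs0]
      norm_num
      ring
    rw [e, ENNReal.ofReal_mul (by positivity)]
    constructor
    · rw [pulledCubic, normHdot10_freeGroup]
      exact (normHdot10_cubic_le hint h1).trans (mul_le_mul_right h2 _)
    · exact (normHdot01_freeGroup_neg_cubic_le hs0 hint h1).trans (mul_le_mul_right h3 _)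
  have hI : ‖Complex.I‖ₑ = 1 := by rw [← ofReal_norm, Complex.norm_I, ENNReal.ofReal_one]
  constructor
  · rw [← normHdot10_profile, profile_eq hu ht]
    refine (normHdot10_sub_le _ _).trans ?_
    rw [normHdot10_smul, hI, one_mul]
    gcongr
    exact (normHdot10_integral_le ht.1 hG (hae.mono fun s hs => hs.1)).trans
      (lintegral_rpow_le hα (by positivity) ht.1)
  · rw [profile_eq hu ht]
    refine (normHdot01_sub_le _ _).trans ?_
    rw [normHdot01_smul, hI, one_mul]
    gcongr
    exact (normHdot01_integral_le ht.1 hG (hae.mono fun s hs => hs.2)).trans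
      (lintegral_rpow_le hα (by positivity) ht.1)

/-! ### Boundedness of the profile in frequency and dispersive decay. -/

theorem decayConst_eq {t : ℝ} (ht : 0 < t) :
    decayConst t = 3 * Real.sqrt Real.pi * t ^ (-(1 / 4) : ℝ) := by
  rw [decayConst, Real.sqrt_div Real.pi_pos.le, Real.sqrt_eq_rpow (Real.sqrt t),
    Real.sqrt_eq_rpow t, ← Real.rpow_mul ht.le, Real.rpow_neg ht.le, ← div_eq_mul_inv,
    mul_div_assoc]
  norm_num

theorem integral_rpow_neg_le {t : ℝ} (ht : 1 ≤ t) :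
    ∫ s in (1 : ℝ)..t, s ^ (-(9 / 8) : ℝ) ≤ 8 := by
  have h0 : (0 : ℝ) ∉ uIcc 1 t := by
    rw [uIcc_of_le ht, mem_Icc]; intro h; linarith [h.1]
  rw [integral_rpow (Or.inr ⟨by norm_num, h0⟩), Real.one_rpow]
  have : 0 ≤ t ^ (-(9 / 8) + 1 : ℝ) := by positivity
  norm_num at this ⊢
  linarith

/-- The uniform bound on the Fourier transform of the profile. -/
theorem norm_fourier_profile_le {α T x : ℝ} (hα : 0 < α) (hα' : α < 1 / 8) (hx : 0 ≤ x)
    {uStar : L2} {u : ℝ → L2} (hu : IsSolution T uStar u)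
    (hX : normX α T u ≤ ENNReal.ofReal x) {t : ℝ} (ht : t ∈ Icc 1 T) (k : ℝ) :
    ‖𝓕 (profile u t : ℝ → ℂ) k‖ ≤
      ‖𝓕 (profile u 1 : ℝ → ℂ) k‖ + 96 * Real.sqrt Real.pi * x ^ 3 := by
  obtain ⟨K, hK⟩ := exists_uniform_bounds hu.continuous
  have h1T : (1 : ℝ) ∈ Icc 1 T := ⟨le_rfl, ht.1.trans ht.2⟩
  have hp : 0 ≤ Real.sqrt Real.pi := Real.sqrt_nonneg _
  have hprofint : ∀ s ∈ Icc 1 T, Integrable (profile u s) := fun s hs =>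
    integrable_of_normHdot01 ((hK s hs).2.2.2.1.trans_lt ENNReal.coe_lt_top).ne
  -- The non-uniform constant `K` is harmless here: it only multiplies `decayConst (R ^ 2)`, which
  -- vanishes as `R → ∞`.
  have hcut : ∀ s ∈ Icc 1 T, ∀ R : ℝ, 0 < R →
      ‖cutoffFourier R k (profile u s) - 𝓕 (profile u s : ℝ → ℂ) k‖ ≤ decayConst (R ^ 2) * K := by
    intro s hs R hR
    have h := (enorm_cutoffFourier_sub_le hR (hprofint s hs) k).trans
      (mul_le_mul_right (hK s hs).2.2.2.1 _)
    rw [← ENNReal.ofReal_coe_nnreal, ← ENNReal.ofReal_mul (decayConst_nonneg _),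
      ← ofReal_norm] at h
    exact (ENNReal.ofReal_le_ofReal_iff
      (mul_nonneg (decayConst_nonneg _) (NNReal.coe_nonneg K))).1 h
  have hG := continuousOn_pulledCubic hu.continuous
  have hbound : ∀ R : ℝ, 0 < R → ‖𝓕 (profile u t : ℝ → ℂ) k‖ ≤
      ‖𝓕 (profile u 1 : ℝ → ℂ) k‖ + 96 * Real.sqrt Real.pi * x ^ 3 +
        decayConst (R ^ 2) * (4 * x ^ 3 * (t - 1) + 2 * K) := by
    intro R hR
    set Λ := cutoffFourier R k with hΛ
    set E : ℝ → ℝ := fun s => 12 * Real.sqrt Real.pi * x ^ 3 * s ^ (-(9 / 8) : ℝ) +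
      4 * x ^ 3 * decayConst (R ^ 2) with hE
    have hrint : IntervalIntegrable (fun s : ℝ => s ^ (-(9 / 8) : ℝ)) volume 1 t := by
      refine intervalIntegral.intervalIntegrable_rpow (Or.inr ?_)
      rw [uIcc_of_le ht.1, mem_Icc]; intro h; linarith [h.1]
    have hEint : IntervalIntegrable E volume 1 t :=
      (hrint.const_mul _).add intervalIntegrable_const
    have hb : ContinuousOn (fun s => Λ (pulledCubic u s)) (Icc 1 t) :=
      Λ.continuous.comp_continuousOn (hG.mono (Icc_subset_Icc_right ht.2))
    have ha : ∀ τ ∈ Icc 1 t, Λ (profile u τ) =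
        Λ (profile u 1) - Complex.I * ∫ s in (1 : ℝ)..τ, Λ (pulledCubic u s) := by
      intro τ hτ
      have hτT : τ ∈ Icc 1 T := ⟨hτ.1, hτ.2.trans ht.2⟩
      have h1 := Λ.intervalIntegral_comp_comm (intervalIntegrable_of_continuousOn_Icc hG hτT)
      rw [h1, profile_eq hu hτT, profile_eq hu h1T]
      simp
    have herr : ∀ᵐ s ∂volume.restrict (Icc 1 t),
        ∃ r : ℝ, ‖Λ (pulledCubic u s) - r * Λ (profile u s)‖ ≤ E s := by
      have hmono : volume.restrict (Icc 1 t) ≤ volume.restrict (Icc 1 T) :=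
        Measure.restrict_mono (Icc_subset_Icc_right ht.2) le_rfl
      filter_upwards [ae_mono hmono (ae_bounds_of_normX_le hx hX),
        ae_restrict_mem measurableSet_Icc] with s hs hst
      obtain ⟨h1, -, h3⟩ := hs
      have hs0 : 0 < s := zero_lt_one.trans_le hst.1
      have hsT : s ∈ Icc 1 T := ⟨hst.1, hst.2.trans ht.2⟩
      have hint : Integrable (u s) := integrable_of_normHdot01
        ((hK s hsT).2.1.trans_lt ENNReal.coe_lt_top).ne
      have hfin : normHdot01 (freeGroup (-s) (u s)) ≠ ∞ :=
        ((hK s hsT).2.2.2.1.trans_lt ENNReal.coe_lt_top).ne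
      obtain ⟨r, hr⟩ := exists_cutoffFourier_cubic_sub_le hs0 hint h1 hfin hR k
      refine ⟨r, hr.trans ?_⟩
      have hA : (normHdot01 (freeGroup (-s) (u s))).toReal ≤ x * s ^ α :=
        ENNReal.toReal_le_of_le_ofReal (by positivity) h3
      have d0 := decayConst_nonneg s
      have d1 := decayConst_nonneg (R ^ 2)
      have hsq : (s ^ (-(1 / 2) : ℝ)) ^ 2 = s ^ (-1 : ℝ) := by
        rw [← Real.rpow_natCast (s ^ (-(1 / 2) : ℝ)) 2, ← Real.rpow_mul hs0.le]; norm_num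
      -- Since `α < 1/8`, the exponent `-5/4 + α` is below `-9/8`. The fixed exponent makes the time
      -- integral at most `8`, giving `12 · 8 = 96` independently of `α`.
      have hp1 : s ^ (-1 : ℝ) * s ^ α * s ^ (-(1 / 4) : ℝ) ≤ s ^ (-(9 / 8) : ℝ) := by
        rw [← Real.rpow_add hs0, ← Real.rpow_add hs0]
        exact Real.rpow_le_rpow_of_exponent_le hst.1 (by linarith)
      have hp2 : s ^ (-1 : ℝ) * s ^ α ≤ 1 := by
        rw [← Real.rpow_add hs0]
        exact Real.rpow_le_one_of_one_le_of_nonpos hst.1 (by linarith)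
      calc _ ≤ 4 * (x * s ^ (-(1 / 2) : ℝ)) ^ 2 * (decayConst s + decayConst (R ^ 2)) *
            (x * s ^ α) := by gcongr
        _ = 12 * Real.sqrt Real.pi * x ^ 3 * (s ^ (-1 : ℝ) * s ^ α * s ^ (-(1 / 4) : ℝ)) +
            4 * x ^ 3 * decayConst (R ^ 2) * (s ^ (-1 : ℝ) * s ^ α) := by
            rw [mul_pow, hsq, decayConst_eq hs0]; ring
        _ ≤ 12 * Real.sqrt Real.pi * x ^ 3 * s ^ (-(9 / 8) : ℝ) +
            4 * x ^ 3 * decayConst (R ^ 2) * 1 := by gcongr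
        _ = E s := by rw [mul_one]
    have hmain := norm_le_of_rotation ht.1 hb ha hEint herr
    have hEle : ∫ s in (1 : ℝ)..t, E s ≤
        96 * Real.sqrt Real.pi * x ^ 3 + 4 * x ^ 3 * decayConst (R ^ 2) * (t - 1) := by
      rw [hE, intervalIntegral.integral_add (hrint.const_mul _) intervalIntegrable_const,
        intervalIntegral.integral_const_mul, intervalIntegral.integral_const, smul_eq_mul]
      have h1 : 12 * Real.sqrt Real.pi * x ^ 3 * ∫ s in (1 : ℝ)..t, s ^ (-(9 / 8) : ℝ) ≤
          12 * Real.sqrt Real.pi * x ^ 3 * 8 :=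
        mul_le_mul_of_nonneg_left (integral_rpow_neg_le ht.1) (by positivity)
      linarith
    have n1 := norm_sub_norm_le (𝓕 (profile u t : ℝ → ℂ) k) (Λ (profile u t))
    rw [norm_sub_rev] at n1
    have n2 := norm_sub_norm_le (Λ (profile u 1)) (𝓕 (profile u 1 : ℝ → ℂ) k)
    have n3 := hcut t ht R hR
    have n4 := hcut 1 h1T R hR
    linarith
  have hd : Tendsto (fun R : ℝ => decayConst (R ^ 2)) atTop (𝓝 0) := by
    have h1 : Tendsto (fun R : ℝ => 3 * Real.sqrt Real.pi * (R ^ 2) ^ (-(1 / 4) : ℝ)) atTop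
        (𝓝 (3 * Real.sqrt Real.pi * 0)) :=
      ((tendsto_rpow_neg_atTop (by norm_num)).comp (tendsto_pow_atTop two_ne_zero)).const_mul _
    rw [mul_zero] at h1
    refine h1.congr' ?_
    filter_upwards [eventually_gt_atTop 0] with R hR
    rw [decayConst_eq (by positivity)]
  have hlim : Tendsto (fun R : ℝ => ‖𝓕 (profile u 1 : ℝ → ℂ) k‖ +
      96 * Real.sqrt Real.pi * x ^ 3 + decayConst (R ^ 2) * (4 * x ^ 3 * (t - 1) + 2 * K)) atTop
      (𝓝 (‖𝓕 (profile u 1 : ℝ → ℂ) k‖ + 96 * Real.sqrt Real.pi * x ^ 3 +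
        0 * (4 * x ^ 3 * (t - 1) + 2 * K))) :=
    tendsto_const_nhds.add (hd.mul_const _)
  rw [zero_mul, add_zero] at hlim
  refine ge_of_tendsto hlim ?_
  filter_upwards [eventually_gt_atTop 0] with R hR using hbound R hR

/-- The dispersive decay bound. -/
theorem decay_bound {α T x ε : ℝ} (hα : 0 < α) (hα' : α < 1 / 8) (hx : 0 ≤ x) (hε : 0 ≤ ε)
    {uStar : L2} {u : ℝ → L2} (hu : IsSolution T uStar u)
    (hX : normX α T u ≤ ENNReal.ofReal x) (h01 : normH01 uStar ≤ ENNReal.ofReal ε) {t : ℝ}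
    (ht : t ∈ Icc 1 T) :
    ENNReal.ofReal (t ^ (1 / 2 : ℝ)) * eLpNorm (u t) ∞ volume ≤
      ENNReal.ofReal (4 * ε + (96 + 9 / α) * x ^ 3) := by
  have h1T : (1 : ℝ) ∈ Icc 1 T := ⟨le_rfl, ht.1.trans ht.2⟩
  have ht0 : 0 < t := zero_lt_one.trans_le ht.1
  have hp : 0 ≤ Real.sqrt Real.pi := Real.sqrt_nonneg _
  -- One `ε` comes from the initial Fourier transform and `96 x³` from its drift. Removing the chirp
  -- adds `3(ε + 3x³/α)`, because `t^{-1/4}` absorbs the growth `t^α`.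
  set B := Real.sqrt Real.pi * (4 * ε + (96 + 9 / α) * x ^ 3) with hB
  have hprof1 : profile u 1 = uStar := by rw [profile_eq hu h1T]; simp
  have hint : Integrable uStar := integrable_of_normHdot01
    (((normHdot01_le_normH01 _).trans h01).trans_lt ENNReal.ofReal_lt_top).ne
  have hstar : ∀ k, ‖𝓕 (uStar : ℝ → ℂ) k‖ ≤ Real.sqrt Real.pi * ε := by
    intro k
    refine (norm_fourier_le k).trans ?_
    rw [integral_norm_eq_lintegral_enorm hint.1, ← eLpNorm_one_eq_lintegral_enorm]
    refine ENNReal.toReal_le_of_le_ofReal (by positivity) ((eLpNorm_one_le_normH01 _).trans ?_)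
    rw [ENNReal.ofReal_mul hp]
    exact mul_le_mul_right h01 _
  have hgrow : normHdot01 (profile u t) ≤ ENNReal.ofReal ((ε + 3 * x ^ 3 / α) * t ^ α) := by
    refine (growth_bounds hα hx hu hX ht).2.trans ?_
    refine (add_le_add_left ((normHdot01_le_normH01 _).trans h01) _).trans ?_
    rw [← ENNReal.ofReal_add hε (by positivity)]
    refine ENNReal.ofReal_le_ofReal ?_
    have : 1 ≤ t ^ α := Real.one_le_rpow ht.1 hα.le
    nlinarith
  have hfint : Integrable (profile u t) :=
    integrable_of_normHdot01 (hgrow.trans_lt ENNReal.ofReal_lt_top).ne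
  have hw : ∀ k, ‖chirpFourier t (profile u t) k‖ ≤ B := by
    intro k
    have h1 := (enorm_fourier_chirp_sub_le ht0 hfint k).trans (mul_le_mul_right hgrow _)
    rw [← ENNReal.ofReal_mul (decayConst_nonneg _), ← ofReal_norm] at h1
    have h2 := (ENNReal.ofReal_le_ofReal_iff
      (mul_nonneg (decayConst_nonneg _) (by positivity))).1 h1
    have h3 : decayConst t * ((ε + 3 * x ^ 3 / α) * t ^ α) ≤
        3 * Real.sqrt Real.pi * (ε + 3 * x ^ 3 / α) := by
      rw [decayConst_eq ht0]
      have h4 : t ^ (-(1 / 4) : ℝ) * t ^ α ≤ 1 := by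
        rw [← Real.rpow_add ht0]
        exact Real.rpow_le_one_of_one_le_of_nonpos ht.1 (by linarith)
      have h5 : 0 ≤ 3 * Real.sqrt Real.pi * (ε + 3 * x ^ 3 / α) := by positivity
      nlinarith
    have h6 := norm_fourier_profile_le hα hα' hx hu hX ht k
    rw [hprof1] at h6
    have h7 := norm_sub_norm_le (chirpFourier t (profile u t) k) (𝓕 (profile u t : ℝ → ℂ) k)
    have h8 := hstar k
    have h9 : B = Real.sqrt Real.pi * ε + 96 * Real.sqrt Real.pi * x ^ 3 +
        3 * Real.sqrt Real.pi * (ε + 3 * x ^ 3 / α) := by rw [hB]; ring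
    have h10 : ‖chirpFourier t (profile u t) k - 𝓕 (profile u t : ℝ → ℂ) k‖ ≤ _ := h2
    linarith
  have hsup := eLpNorm_top_le_of_ae_norm_le (ae_norm_le_of_chirpFourier ht0 (u t) hfint hw)
  have hrpow : ENNReal.ofReal (t ^ (1 / 2 : ℝ)) = ENNReal.ofReal (t ^ (-(-(1 / 2)) : ℝ)) := by
    rw [neg_neg]
  rw [hrpow]
  refine rpow_mul_le_of_le_ofReal ht0 (hsup.trans (ENNReal.ofReal_le_ofReal ?_))
  -- The left side is `(2t)^{-1/2}`.
  have h2p : 1 / Real.sqrt (2 * Real.pi * t) * Real.sqrt Real.pi ≤ t ^ (-(1 / 2) : ℝ) := by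
    rw [Real.rpow_neg ht0.le, ← Real.sqrt_eq_rpow, Real.sqrt_mul (by positivity),
      Real.sqrt_mul (by positivity), one_div_mul_eq_div]
    have hs2 : 1 ≤ Real.sqrt 2 := by rw [Real.one_le_sqrt]; norm_num
    have hspi : 0 < Real.sqrt Real.pi := Real.sqrt_pos.2 Real.pi_pos
    have hst : 0 < Real.sqrt t := Real.sqrt_pos.2 ht0
    rw [div_le_iff₀ (by positivity)]
    field_simp
    exact hs2
  calc _ = (1 / Real.sqrt (2 * Real.pi * t) * Real.sqrt Real.pi) *
        (4 * ε + (96 + 9 / α) * x ^ 3) := by rw [hB]; ring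
    _ ≤ t ^ (-(1 / 2) : ℝ) * (4 * ε + (96 + 9 / α) * x ^ 3) := by gcongr
    _ = _ := mul_comm _ _

/-! ### Assembly of the a priori estimate. -/

/-- The a priori estimate in `X_T` with explicit constants. -/
theorem normX_le {α T x ε : ℝ} (hα : 0 < α) (hα' : α < 1 / 8) (hx : 0 ≤ x) (hε : 0 ≤ ε)
    {uStar : L2} {u : ℝ → L2} (hu : IsSolution T uStar u)
    (hX : normX α T u ≤ ENNReal.ofReal x)
    (h : normH10 uStar + normH01 uStar ≤ ENNReal.ofReal ε) :
    normX α T u ≤ ENNReal.ofReal (7 * ε + (96 + 15 / α) * x ^ 3) := by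
  have h10 : normHdot10 uStar ≤ ENNReal.ofReal ε :=
    (normHdot10_le_normH10 _).trans (le_self_add.trans h)
  have h01' : normH01 uStar ≤ ENNReal.ofReal ε := le_add_self.trans h
  have h01 : normHdot01 uStar ≤ ENNReal.ofReal ε := (normHdot01_le_normH01 _).trans h01'
  have hg : ∀ t ∈ Icc 1 T, ∀ N A : ℝ≥0∞, A ≤ ENNReal.ofReal ε →
      N ≤ A + ENNReal.ofReal (3 * x ^ 3 / α * t ^ α) →
      ENNReal.ofReal (t ^ (-α)) * N ≤ ENNReal.ofReal (ε + 3 * x ^ 3 / α) := by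
    intro t ht N A hA hN
    refine rpow_mul_le_of_le_ofReal (zero_lt_one.trans_le ht.1) ?_
    refine (hN.trans (add_le_add_left hA _)).trans ?_
    rw [← ENNReal.ofReal_add hε (mul_nonneg (by positivity)
      (Real.rpow_nonneg (zero_le_one.trans ht.1) _))]
    refine ENNReal.ofReal_le_ofReal ?_
    have : 1 ≤ t ^ α := Real.one_le_rpow ht.1 hα.le
    nlinarith
  have s1 : supTime T (fun t => ENNReal.ofReal (t ^ (1 / 2 : ℝ)) * eLpNorm (u t) ∞ volume) ≤
      ENNReal.ofReal (4 * ε + (96 + 9 / α) * x ^ 3) :=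
    supTime_le fun t ht => decay_bound hα hα' hx hε hu hX h01' ht
  have s2 : supTime T (fun t => ENNReal.ofReal (t ^ (-α)) * normHdot10 (u t)) ≤
      ENNReal.ofReal (ε + 3 * x ^ 3 / α) :=
    supTime_le fun t ht => hg t ht _ _ h10 (growth_bounds hα hx hu hX ht).1
  have s3 : supTime T (fun t => ENNReal.ofReal (t ^ (-α)) * normHdot01 (profile u t)) ≤
      ENNReal.ofReal (ε + 3 * x ^ 3 / α) :=
    supTime_le fun t ht => hg t ht _ _ h01 (growth_bounds hα hx hu hX ht).2
  have s4 : supTime T (fun t => eLpNorm (u t) 2 volume) ≤ ENNReal.ofReal ε := by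
    refine supTime_le fun t ht => ?_
    rw [eLpNorm_coeFn, ← ofReal_norm, norm_eq_of_isSolution hu ht, ofReal_norm, ← eLpNorm_coeFn]
    exact (eLpNorm_le_normH01 _).trans h01'
  unfold normX
  refine (add_le_add (add_le_add (add_le_add s1 s2) s3) s4).trans ?_
  rw [← ENNReal.ofReal_add (by positivity) (by positivity),
    ← ENNReal.ofReal_add (by positivity) (by positivity),
    ← ENNReal.ofReal_add (by positivity) (by positivity)]
  -- The four norms contribute `4+1+1+1 = 7` to the coefficient of `ε`, and `9+3+3 = 15` to that of
  -- `x³/α`.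
  refine ENNReal.ofReal_le_ofReal (le_of_eq ?_)
  ring

end NLS

end

theorem proposition1p3 :
    ∃ (C₀ : ℝ≥0) (α₀ : ℝ), 0 < α₀ ∧ ∀ α : ℝ, 0 < α → α < α₀ →
      ∃ C : ℝ≥0, ∀ (ε : ℝ≥0) (T : ℝ) (uStar : NLS.L2) (u : ℝ → NLS.L2),
        1 < T →
        NLS.normH10 uStar + NLS.normH01 uStar ≤ ε →
        NLS.IsSolution T uStar u →
        NLS.normX α T u < ∞ ∧
        NLS.normX α T u ≤ C₀ * ε + C * NLS.normX α T u ^ 3 := by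
  refine ⟨7, 1 / 8, by norm_num, fun α hα hα' => ⟨(96 + 15 / α).toNNReal, ?_⟩⟩
  intro ε T uStar u _ hsmall hu
  have hfin := NLS.normX_lt_top hα hu.continuous
  refine ⟨hfin, ?_⟩
  -- The explicit estimate is applied with `x` equal to the norm itself, which finiteness permits.
  have hX : NLS.normX α T u = ENNReal.ofReal (NLS.normX α T u).toReal :=
    (ENNReal.ofReal_toReal hfin.ne).symm
  have hε : (ε : ℝ≥0∞) = ENNReal.ofReal (ε : ℝ) := ENNReal.ofReal_coe_nnreal.symm
  rw [hε] at hsmall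
  have h := NLS.normX_le hα hα' ENNReal.toReal_nonneg (NNReal.coe_nonneg ε) hu hX.le hsmall
  have hx0 : 0 ≤ (NLS.normX α T u).toReal := ENNReal.toReal_nonneg
  have hε0 : (0 : ℝ) ≤ ε := NNReal.coe_nonneg ε
  refine h.trans (le_of_eq ?_)
  rw [ENNReal.ofReal_add (by positivity) (by positivity), ENNReal.ofReal_mul (by positivity),
    ENNReal.ofReal_mul (by positivity), ENNReal.ofReal_pow hx0, ← hX, ← hε, ENNReal.ofReal_ofNat]
  rfl
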